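/- Let $M=\{m_{ij} : i,j\in\mathbb{Z}_3\}$, with the six contexts $C_i^{\mathrm{hor}}=\{m_{ij}: j\in\mathbb{Z}_3\}$ and $C_j^{\mathrm{ver}}=\{m_{ij}: i\in\mathbb{Z}_3\}$ forming the set $\mathcal{C}$. For $\beta:\mathcal{C}\to\mathbb{Z}_2$ the Mermin polytope $\mathrm{MP}_\beta$ is the set of families $p=(p_C)_{C\in\mathcal{C}}$ of probability distributions $p_C$ on $\mathbb{Z}_2^C$ such that $p_C$ and $p_{C'}$ have the same marginal on $\mathbb{Z}_2^{C\cap C'}$ for all $C,C'\in\mathcal{C}$, and such that every $p_C$ is supported in $O_\beta(C)=\{s:C\to\mathbb{Z}_2 : \sum_{m\in C}s(m)=\beta(C)\}$. For $m\in M$ let $p_m^0$ be the probability of the outcome $0$ for $m$, computed in any context containing $m$. Write $\mathrm{MP}_0=\mathrm{MP}_{\beta_0}$ with $\beta_0=0$, and $\mathrm{MP}_1=\mathrm{MP}_{\beta_1}$ with $\beta_1=0$ on the horizontal and $\beta_1=1$ on the vertical contexts. A subset $\Omega\subseteq M$ is closed if every context containing two distinct elements of $\Omega$ is contained in $\Omega$.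 A function $s:\Omega\to\mathbb{Z}_2$ is an outcome assignment (with respect to $\beta$) if $s|_C\in O_\beta(C)$ for every context $C\subseteq\Omega$. A closed set that admits an outcome assignment is called closed noncontextual (cnc), and a maximal cnc set is one that is maximal under inclusion. A subset $\Omega\subseteq M$ is of type 1 if it consists of three elements no two of which lie in a common context, and of type 2 if it is the union of two distinct contexts that intersect in a single element. A function $s:M\to\mathbb{Z}_2$ is called a homomorphism if $s(c)=s(a)+s(b)$ for every context $\{a,b,c\}$. **Theorem.** (i) There is a bijection between the homomorphisms $s:M\to\mathbb{Z}_2$ and the vertices of $\mathrm{MP}_0$. The vertex $p$ corresponding to $s$ is the deterministic one, i.e. each $p_C$ is the point mass at $s|_C$, and it is the unique point of $\mathrm{MP}_0$ with $p_m^0=\frac{1+(-1)^{s(m)}}{2}$ for all $m\in M$. Restriction is a bijection from the homomorphisms $s:M\to\mathbb{Z}_2$ to the functions $\{m_{00},m_{01},m_{10},m_{11}\}\to\mathbb{Z}_2$. In particular, $\mathrm{MP}_0$ has exactly $16$ vertices. (ii) With respect to $\beta_1$, the maximal cnc sets are exactly the subsets of type 1 and the subsets of type 2. There is a bijection between the pairs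 $(\Omega,s)$, where $\Omega\subseteq M$ is a maximal cnc set and $s:\Omega\to\mathbb{Z}_2$ is an outcome assignment, and the vertices of $\mathrm{MP}_1$. The vertex $p$ corresponding to $(\Omega,s)$ is the unique point of $\mathrm{MP}_1$ with $$p_m^0=\frac{1+(-1)^{s(m)}}{2}\ \text{ for } m\in\Omega,\qquad p_m^0=\frac12\ \text{ for } m\notin\Omega.$$ There are exactly $48$ vertices with $\Omega$ of type 1 and exactly $72$ vertices with $\Omega$ of type 2. -/

import Mathlib

namespace Mermin

/-- A measurement scenario on the measurement set `M` with outcome set `ℤ₂`: a collection of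
subsets of `M`, the contexts, labelled without repetition by `ι`, that covers `M`. -/
structure Scenario (M ι : Type) [DecidableEq M] where
  context : ι → Finset M
  context_injective : Function.Injective context
  cover : ∀ m : M, ∃ c : ι, m ∈ context c

section General

variable {M ι : Type} [DecidableEq M]

/-- The ambient real vector space of families `(p_C)` of functions `p_C : ℤ₂^C → ℝ`. -/
abbrev Scenario.Family (S : Scenario M ι) : Type :=
  (c : ι) → (S.context c → ZMod 2) → ℝ

/-- The restriction of a function `q : ℤ₂^C → ℝ` to `U ⊆ C`, that is, its marginal on `ℤ₂^U`. -/
def marginal {C U : Finset M} (h : U ⊆ C) (q : (C → ZMod 2) → ℝ) (t : U → ZMod 2) : ℝ :=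
  ∑ s : C → ZMod 2 with Finset.restrict₂ (π := fun _ => ZMod 2) h s = t, q s

/-- The nonsignaling polytope: families of probability distributions on the contexts whose
marginals on the intersections agree. -/
def Scenario.NS (S : Scenario M ι) : Set S.Family :=
  {p | (∀ c s, 0 ≤ p c s) ∧ (∀ c, ∑ s, p c s = 1) ∧
    ∀ c c', marginal (U := S.context c ∩ S.context c') Finset.inter_subset_left (p c) =
      marginal (U := S.context c ∩ S.context c') Finset.inter_subset_right (p c')}

/-- `O_β(C)`: the outcome assignments on the context `C`. -/
def Scenario.O (S : Scenario M ι) (β : ι → ZMod 2) (c : ι) : Set (S.context c → ZMod 2) :=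
  {s | ∑ m, s m = β c}

/-- The nonsignaling families such that every `p_C` is supported in `O_β(C)`. -/
def Scenario.NSβ (S : Scenario M ι) (β : ι → ZMod 2) : Set S.Family :=
  {p | p ∈ S.NS ∧ ∀ c, Function.support (p c) ⊆ S.O β c}

/-- `p_m^0` computed in the context `C ∋ m`: the probability of the outcome `0` for `m`. -/
def Scenario.probZero (S : Scenario M ι) (p : S.Family) (c : ι) (m : S.context c) : ℝ :=
  ∑ s : S.context c → ZMod 2 with s m = 0, p c s

/-- `Ω` is closed (under inference): a context that meets `Ω` in two distinct measurements is
contained in `Ω`. -/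
def Scenario.IsClosed (S : Scenario M ι) (Ω : Finset M) : Prop :=
  ∀ c, ∀ a ∈ S.context c ∩ Ω, ∀ b ∈ S.context c ∩ Ω, a ≠ b → S.context c ⊆ Ω

/-- `s : Ω → ℤ₂` is an outcome assignment: it restricts to an outcome assignment on every context
contained in `Ω`. -/
def Scenario.IsOutcomeAssignment (S : Scenario M ι) (β : ι → ZMod 2) (Ω : Finset M)
    (s : Ω → ZMod 2) : Prop :=
  ∀ (c : ι) (h : S.context c ⊆ Ω), Finset.restrict₂ (π := fun _ => ZMod 2) h s ∈ S.O β c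

/-- Closed noncontextual sets. -/
def Scenario.IsCnc (S : Scenario M ι) (β : ι → ZMod 2) (Ω : Finset M) : Prop :=
  S.IsClosed Ω ∧ ∃ s : Ω → ZMod 2, S.IsOutcomeAssignment β Ω s

/-- Pairs `(Ω, s)` of a maximal (for inclusion) closed noncontextual set `Ω` and an outcome
assignment `s` on `Ω`. -/
abbrev Scenario.CncPair (S : Scenario M ι) (β : ι → ZMod 2) : Type :=
  {x : (Ω : Finset M) × (Ω → ZMod 2) //
    Maximal (S.IsCnc β) x.1 ∧ S.IsOutcomeAssignment β x.1 x.2}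

/-- Type 1: three measurements, no two of which lie in a common context. -/
def Scenario.IsType1 (S : Scenario M ι) (Ω : Finset M) : Prop :=
  Ω.card = 3 ∧ ∀ a ∈ Ω, ∀ b ∈ Ω, a ≠ b → ∀ c, ¬ (a ∈ S.context c ∧ b ∈ S.context c)

/-- Type 2: the union of two distinct contexts that intersect in a single measurement. -/
def Scenario.IsType2 (S : Scenario M ι) (Ω : Finset M) : Prop :=
  ∃ c c' m, c ≠ c' ∧ S.context c ∩ S.context c' = {m} ∧ Ω = S.context c ∪ S.context c'

/-- The marginals prescribed by `s : Ω → ℤ₂`: `p_m^0 = (1 + (-1)^{s(m)}) / 2` for `m ∈ Ω` and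
`p_m^0 = 1/2` for `m ∉ Ω`. -/
def Scenario.HasMarginals (S : Scenario M ι) (p : S.Family) (Ω : Finset M)
    (s : Ω → ZMod 2) : Prop :=
  ∀ (c : ι) (m : S.context c), S.probZero p c m =
    if h : (m : M) ∈ Ω then (1 + (-1 : ℝ) ^ (s ⟨m, h⟩).val) / 2 else 1 / 2

end General

/-- The nine measurements `m_{ij}`. -/
abbrev Meas : Type := Fin 3 × Fin 3

/-- Labels of the six contexts: `inl i` is the horizontal one `C_i`, `inr j` the vertical one. -/
abbrev Ctx : Type := Fin 3 ⊕ Fin 3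

/-- The Mermin scenario. -/
def square : Scenario Meas Ctx where
  context := Sum.elim (fun i => Finset.univ.image fun j => (i, j))
    (fun j => Finset.univ.image fun i => (i, j))
  context_injective := by decide
  cover := by decide

/-- The Mermin polytope for `β`. -/
def MP (β : Ctx → ZMod 2) : Set square.Family := square.NSβ β

/-- The vertices of the Mermin polytope. -/
def vertices (β : Ctx → ZMod 2) : Set square.Family := (MP β).extremePoints ℝ

/-- `β₀ = 0` on all contexts. -/
def β₀ : Ctx → ZMod 2 := fun _ => 0

/-- `β₁` is `0` on the horizontal and `1` on the vertical contexts. -/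
def β₁ : Ctx → ZMod 2 := Sum.elim (fun _ => 0) (fun _ => 1)

/-- Group homomorphisms `M → ℤ₂`, where the sum of two distinct measurements of a context is the
third one: `s(c) = s(a) + s(b)` for every context `{a, b, c}`. -/
def IsHom (s : Meas → ZMod 2) : Prop :=
  ∀ C a b c, square.context C = {a, b, c} → s c = s a + s b

/-- `{m₀₀, m₀₁, m₁₀, m₁₁}`. -/
def corner : Finset Meas := {(0, 0), (0, 1), (1, 0), (1, 1)}

end Mermin

namespace Mermin

/-! ### Combinatorics of closed sets of the square -/

/-! Put `u m = 2 p_m^0 - 1`. Each `O_β(C)` has four elements, and a Fourier inversion gives `p_C(s)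
= (1 + ∑ (-1)^{s(m)} u m) / 4` there (`four_mul_eq`). So the Mermin polytope is affinely a polytope
in `ℝ^9` cut out by 24 inequalities, and extreme points may be computed in coordinates
(`ofCoords_mem_vertices_iff`).

If one coordinate of a context is `±1`, the other two agree up to a sign fixed by `β`
(`coord_eq_of_eq_sgn`). Hence the set `E` of coordinates equal to `±1` is closed and carries an
outcome assignment. Two different tight inequalities of one context force one of its coordinates to
be `±1`; given the coordinates in `E`, each context not inside `E` therefore contributes at most one
further condition. At a vertex the tight conditions have rank 9, so `9 ≤ |E| + #{C ⊄ E}`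
(`nine_le_of_extreme`). Among closed sets only transversals (3 + 6), crosses (5 + 4) and the whole
square (9 + 0) meet this bound (`isClosed_classification`).

The parity of `β` decides which of these occur. For `β₁` no global assignment exists, so `E` is a
transversal or a cross. Off `E` all `|u m|` are equal, and a nonzero common value would have signs
forming a global assignment; so `u` vanishes there (`IsBig.eq_zero_of_notMem`). Conversely this
rigidity makes every such point extreme. For `β₀` every assignment on a transversal or a cross
extends to the square, and the extension gives a direction along which the point can move
(`IsBig.not_extreme`); only deterministic points remain. -/

@[simp] theorem mem_context_inl {i : Fin 3} {m : Meas} :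
    m ∈ square.context (.inl i) ↔ m.1 = i := by
  revert i m; decide

@[simp] theorem mem_context_inr {j : Fin 3} {m : Meas} :
    m ∈ square.context (.inr j) ↔ m.2 = j := by
  revert j m; decide

theorem card_context (C : Ctx) : (square.context C).card = 3 := by
  revert C; decide

theorem nonempty_context (C : Ctx) : Nonempty (square.context C) := by
  rw [← Fintype.card_pos_iff, Fintype.card_coe, card_context]; omega

/-- Two measurements are collinear if they lie in a common context. -/
def Collinear (a b : Meas) : Prop := a.1 = b.1 ∨ a.2 = b.2

theorem collinear_iff {a b : Meas} :
    Collinear a b ↔ ∃ C, a ∈ square.context C ∧ b ∈ square.context C := by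
  simp [Collinear, eq_comm]

/-- The union of a horizontal and a vertical context. -/
def cross (i j : Fin 3) : Finset Meas := square.context (.inl i) ∪ square.context (.inr j)

/-- The graph of a permutation. -/
def transversal (π : Equiv.Perm (Fin 3)) : Finset Meas := Finset.univ.image fun i => (i, π i)

@[simp] theorem mem_cross {i j : Fin 3} {m : Meas} : m ∈ cross i j ↔ m.1 = i ∨ m.2 = j := by
  simp [cross]

@[simp] theorem mem_transversal {π : Equiv.Perm (Fin 3)} {m : Meas} :
    m ∈ transversal π ↔ π m.1 = m.2 := by
  obtain ⟨a, b⟩ := m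
  simp [transversal]

theorem card_cross (i j : Fin 3) : (cross i j).card = 5 := by
  revert i j; decide

theorem card_transversal (π : Equiv.Perm (Fin 3)) : (transversal π).card = 3 := by
  rw [transversal, Finset.card_image_of_injective _ fun a b h => by simpa using congrArg Prod.fst h]
  simp

/-- A set without two distinct collinear elements lies in a transversal. -/
theorem exists_subset_transversal {Ω : Finset Meas}
    (h : ∀ a ∈ Ω, ∀ b ∈ Ω, a ≠ b → ¬ Collinear a b) : ∃ π, Ω ⊆ transversal π := by
  have hex : ∀ i, ∃ j, i ∈ Ω.image Prod.fst → (i, j) ∈ Ω := by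
    intro i
    by_cases hi : i ∈ Ω.image Prod.fst
    · obtain ⟨m, hm, rfl⟩ := Finset.mem_image.1 hi
      exact ⟨m.2, fun _ => hm⟩
    -- In a row that misses `Ω` the value is irrelevant.
    · exact ⟨0, fun h => absurd h hi⟩
  choose f hf using hex
  -- The partial map from occupied rows to columns is injective, so it extends to a permutation.
  obtain ⟨g, hg⟩ := Finset.exists_equiv_extend_of_card_eq (α := Fin 3)
    (t := (Finset.univ : Finset (Fin 3))) (by simp) (s := Ω.image Prod.fst) (f := f) (by simp) (by
      intro a ha b hb hab
      by_contra hne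
      exact h _ (hf a ha) _ (hf b hb) (fun e => hne (congrArg Prod.fst e)) (.inr hab))
  refine ⟨g.trans (Equiv.subtypeUnivEquiv Finset.mem_univ), fun m hm => ?_⟩
  have hm1 : m.1 ∈ Ω.image Prod.fst := Finset.mem_image_of_mem _ hm
  rw [mem_transversal]
  change (g m.1 : Fin 3) = m.2
  rw [hg _ hm1]
  by_contra hne
  exact h _ (hf _ hm1) _ hm (fun e => hne (congrArg Prod.snd e)) (.inl rfl)

theorem not_collinear_of_mem_transversal {π : Equiv.Perm (Fin 3)} {a b : Meas}
    (ha : a ∈ transversal π) (hb : b ∈ transversal π) (hab : a ≠ b) : ¬ Collinear a b := by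
  rw [mem_transversal] at ha hb
  rintro (h | h)
  · exact hab (Prod.ext h (by rw [← ha, ← hb, h]))
  · exact hab (Prod.ext (π.injective (by rw [ha, hb, h])) h)

theorem isType1_iff (Ω : Finset Meas) : square.IsType1 Ω ↔ ∃ π, Ω = transversal π := by
  constructor
  · rintro ⟨hcard, h⟩
    obtain ⟨π, hπ⟩ := exists_subset_transversal (Ω := Ω) fun a ha b hb hab hc =>
      let ⟨C, hC⟩ := collinear_iff.1 hc
      h a ha b hb hab C hC
    exact ⟨π, Finset.eq_of_subset_of_card_le hπ (by rw [card_transversal, hcard])⟩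
  · rintro ⟨π, rfl⟩
    exact ⟨card_transversal π, fun a ha b hb hab C hC =>
      not_collinear_of_mem_transversal ha hb hab (collinear_iff.2 ⟨C, hC⟩)⟩

theorem isType2_iff (Ω : Finset Meas) : square.IsType2 Ω ↔ ∃ i j, Ω = cross i j := by
  constructor
  · rintro ⟨c | c, c' | c', m, hc, h, rfl⟩
    · have h1 : m ∈ square.context (.inl c) ∩ square.context (.inl c') := by simp [h]
      simp only [Finset.mem_inter, mem_context_inl] at h1
      exact absurd (by rw [← h1.1, ← h1.2]) hc
    · exact ⟨c, c', rfl⟩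
    · exact ⟨c', c, Finset.union_comm _ _⟩
    · have h1 : m ∈ square.context (.inr c) ∩ square.context (.inr c') := by simp [h]
      simp only [Finset.mem_inter, mem_context_inr] at h1
      exact absurd (by rw [← h1.1, ← h1.2]) hc
  · rintro ⟨i, j, rfl⟩
    exact ⟨.inl i, .inr j, (i, j), by simp, by ext ⟨a, b⟩; simp, rfl⟩

theorem isClosed_transversal (π : Equiv.Perm (Fin 3)) : square.IsClosed (transversal π) := by
  intro C a ha b hb hab
  rw [Finset.mem_inter] at ha hb
  exact absurd (collinear_iff.2 ⟨C, ha.1, hb.1⟩) (not_collinear_of_mem_transversal ha.2 hb.2 hab)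

theorem isClosed_cross (i j : Fin 3) : square.IsClosed (cross i j) := by
  rintro (C | C) a ha b hb hab m hm <;>
    simp only [Finset.mem_inter, mem_context_inl, mem_context_inr, mem_cross] at ha hb hm ⊢
  · obtain ⟨rfl, h | h⟩ := ha
    · exact .inl (hm.trans h)
    · obtain ⟨h', h'' | h''⟩ := hb
      · exact .inl (by rw [hm, ← h', h''])
      · exact absurd (Prod.ext h'.symm (h.trans h''.symm)) hab
  · obtain ⟨rfl, h | h⟩ := ha
    · obtain ⟨h', h'' | h''⟩ := hb
      · exact absurd (Prod.ext (h.trans h''.symm) h'.symm) hab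
      · exact .inr (by rw [hm, ← h', h''])
    · exact .inr (hm.trans h)

/-- An extra point shares its row with a point of column `j`, so that row is included. Every column
then contains two known points, one in row `i` and one in the new row. -/
theorem eq_univ_of_cross_ssubset {Ω : Finset Meas} (hΩ : square.IsClosed Ω) {i j : Fin 3}
    (h : cross i j ⊆ Ω) (hne : Ω ≠ cross i j) : Ω = Finset.univ := by
  obtain ⟨x, hx, hx'⟩ : ∃ x ∈ Ω, x ∉ cross i j := by
    by_contra! hcon
    exact hne (Finset.Subset.antisymm hcon h)
  simp only [mem_cross, not_or] at hx'
  have hrow : square.context (.inl x.1) ⊆ Ω :=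
    hΩ _ x (by simp [hx]) (x.1, j)
      (by simp only [Finset.mem_inter, mem_context_inl, true_and]; exact h (by simp))
      fun e => hx'.2 (congrArg Prod.snd e)
  refine Finset.eq_univ_of_forall fun y => ?_
  refine hΩ (.inr y.2) (i, y.2) ?_ (x.1, y.2) ?_ (fun e => hx'.1 (congrArg Prod.fst e).symm)
    (by simp)
  · simp only [Finset.mem_inter, mem_context_inr, true_and]; exact h (by simp)
  · simp only [Finset.mem_inter, mem_context_inr, true_and]; exact hrow (by simp)

theorem context_inter_nonempty_of_notMem : ∀ (C : Ctx) (x : Meas), x ∉ square.context C →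
    ∃ C', x ∈ square.context C' ∧ (∃ y ∈ square.context C', y ∈ square.context C) ∧
      ∃ i j, square.context C ∪ square.context C' = cross i j := by
  rintro (i | j) x hx
  · exact ⟨.inr x.2, by simp, ⟨(i, x.2), by simp⟩, i, x.2, rfl⟩
  · exact ⟨.inl x.1, by simp, ⟨(x.1, j), by simp⟩, x.1, j, Finset.union_comm _ _⟩

/-- Closed sets are the whole square, crosses, transversals, or small sets contained in one of
these. -/
theorem isClosed_classification {Ω : Finset Meas} (hΩ : square.IsClosed Ω) :
    Ω = Finset.univ ∨ (∃ i j, Ω = cross i j) ∨ (∃ π, Ω = transversal π) ∨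
      ((Ω.card + (Finset.univ.filter fun C => ¬ square.context C ⊆ Ω).card ≤ 8 ∧ Ω.card ≤ 3) ∧
        ((∃ i j, Ω ⊆ cross i j) ∨ ∃ π, Ω ⊆ transversal π)) := by
  by_cases hC : ∃ C, square.context C ⊆ Ω
  · obtain ⟨C, hC⟩ := hC
    by_cases hx : ∃ x ∈ Ω, x ∉ square.context C
    · obtain ⟨x, hxΩ, hx⟩ := hx
      obtain ⟨C', hxC', ⟨y, hyC', hyC⟩, i, j, hij⟩ := context_inter_nonempty_of_notMem C x hx
      have hC' : square.context C' ⊆ Ω :=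
        hΩ C' x (by simp [*]) y (by simp [hC hyC, *]) fun e => hx (e ▸ hyC)
      have hsub : cross i j ⊆ Ω := hij ▸ Finset.union_subset hC hC'
      by_cases he : Ω = cross i j
      · exact .inr (.inl ⟨i, j, he⟩)
      · exact .inl (eq_univ_of_cross_ssubset hΩ hsub he)
    · push Not at hx
      obtain rfl : Ω = square.context C := Finset.Subset.antisymm hx hC
      -- A single context misses the bound 9 by one: three points and five contexts not contained in
      -- it.
      refine .inr (.inr (.inr ⟨⟨?_, (card_context C).le⟩, .inl ?_⟩))
      · have h : ∀ C, (square.context C).card +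
            (Finset.univ.filter fun C' => ¬ square.context C' ⊆ square.context C).card ≤ 8 := by
          decide
        exact h C
      · cases C with
        | inl i => exact ⟨i, 0, Finset.subset_union_left⟩
        | inr j => exact ⟨0, j, Finset.subset_union_right⟩
  · obtain ⟨π, hπ⟩ := exists_subset_transversal (Ω := Ω) fun a ha b hb hab hc => by
      obtain ⟨C, h1, h2⟩ := collinear_iff.1 hc
      exact hC ⟨C, hΩ C a (by simp [*]) b (by simp [*]) hab⟩
    by_cases he : Ω = transversal π
    · exact .inr (.inr (.inl ⟨π, he⟩))
    · have hlt := Finset.card_lt_card (hπ.ssubset_of_ne he)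
      rw [card_transversal] at hlt
      have h6 := Finset.card_filter_le (Finset.univ : Finset Ctx)
        fun C => ¬ square.context C ⊆ Ω
      have : (Finset.univ : Finset Ctx).card = 6 := rfl
      exact .inr (.inr (.inr ⟨⟨by omega, by omega⟩, .inr ⟨π, hπ⟩⟩))

/-- Crosses and transversals. -/
def IsBig (Ω : Finset Meas) : Prop := (∃ π, Ω = transversal π) ∨ ∃ i j, Ω = cross i j

theorem isBig_iff (Ω : Finset Meas) : IsBig Ω ↔ square.IsType1 Ω ∨ square.IsType2 Ω := by
  rw [isType1_iff, isType2_iff, IsBig]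

theorem IsBig.isClosed {Ω : Finset Meas} (h : IsBig Ω) : square.IsClosed Ω := by
  obtain ⟨π, rfl⟩ | ⟨i, j, rfl⟩ := h
  exacts [isClosed_transversal π, isClosed_cross i j]

theorem IsBig.ne_univ {Ω : Finset Meas} (h : IsBig Ω) : Ω ≠ Finset.univ := by
  have h9 : (Finset.univ : Finset Meas).card = 9 := rfl
  obtain ⟨π, rfl⟩ | ⟨i, j, rfl⟩ := h
  · intro h; have := card_transversal π; rw [h] at this; omega
  · intro h; have := card_cross i j; rw [h] at this; omega

/-- This supplies a deterministic coordinate in every context, which ties the other two coordinates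
together. -/
theorem IsBig.exists_mem_context {Ω : Finset Meas} (h : IsBig Ω) (C : Ctx) :
    ∃ m ∈ square.context C, m ∈ Ω := by
  obtain ⟨π, rfl⟩ | ⟨i, j, rfl⟩ := h <;> obtain C | C := C
  · exact ⟨(C, π C), by simp⟩
  · exact ⟨(π.symm C, C), by simp⟩
  · exact ⟨(C, j), by simp⟩
  · exact ⟨(i, C), by simp⟩

/-- The complement of a cross or a transversal is connected. -/
theorem IsBig.exists_path {Ω : Finset Meas} (h : IsBig Ω) {a b : Meas} (ha : a ∉ Ω) (hb : b ∉ Ω) :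
    ∃ x ∉ Ω, ∃ y ∉ Ω, Collinear a x ∧ Collinear x y ∧ Collinear y b := by
  obtain ⟨π, rfl⟩ | ⟨i, j, rfl⟩ := h
  · simp only [mem_transversal] at *
    by_cases h1 : π a.1 = b.2
    · by_cases h2 : π b.1 = a.2
      -- Both other corners of the rectangle spanned by `a` and `b` lie on the transversal, so the
      -- path detours through the column `π k` of the third row.
      · have hthird : ∀ i j : Fin 3, ∃ k, k ≠ i ∧ k ≠ j := by decide
        obtain ⟨k, hka, hkb⟩ := hthird a.1 b.1
        exact ⟨(a.1, π k), fun h => hka (π.injective h).symm, (b.1, π k),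
          fun h => hkb (π.injective h).symm, .inl rfl, .inr rfl, .inl rfl⟩
      · exact ⟨(b.1, a.2), h2, b, hb, .inr rfl, .inl rfl, .inl rfl⟩
    · exact ⟨(a.1, b.2), h1, b, hb, .inl rfl, .inr rfl, .inl rfl⟩
  · simp only [mem_cross, not_or] at *
    exact ⟨(a.1, b.2), ⟨ha.1, hb.2⟩, b, hb, .inl rfl, .inr rfl, .inl rfl⟩

theorem IsBig.eq_univ_of_ssubset {Ω Ω' : Finset Meas} (h : IsBig Ω) (hΩ' : square.IsClosed Ω')
    (hsub : Ω ⊆ Ω') (hne : Ω' ≠ Ω) : Ω' = Finset.univ := by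
  obtain ⟨π, rfl⟩ | ⟨i, j, rfl⟩ := h
  · have hlt := Finset.card_lt_card (hsub.ssubset_of_ne hne.symm)
    rw [card_transversal] at hlt
    obtain h | ⟨i, j, rfl⟩ | ⟨π', rfl⟩ | h := isClosed_classification hΩ'
    · exact h
    · exfalso
      -- A cross holds at most two points of a transversal: the one in row `i` and the one in column
      -- `j`.
      have hk : ∀ k, k = i ∨ π k = j := fun k => by
        simpa using hsub (show (k, π k) ∈ transversal π by simp)
      have : ∀ k, k = i ∨ k = π.symm j := fun k => by
        simpa [Equiv.eq_symm_apply] using hk k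
      have hcov : ∀ i l : Fin 3, ¬ ∀ k, k = i ∨ k = l := by decide
      exact hcov i _ this
    · rw [card_transversal] at hlt; omega
    · omega
  · exact eq_univ_of_cross_ssubset hΩ' hsub hne

theorem IsBig.exists_of_isClosed {Ω : Finset Meas} (h : square.IsClosed Ω)
    (hne : Ω ≠ Finset.univ) : ∃ Ω', IsBig Ω' ∧ Ω ⊆ Ω' := by
  obtain h | ⟨i, j, rfl⟩ | ⟨π, rfl⟩ | ⟨-, ⟨i, j, h⟩ | ⟨π, h⟩⟩ := isClosed_classification h
  · exact absurd h hne
  · exact ⟨_, .inr ⟨i, j, rfl⟩, subset_rfl⟩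
  · exact ⟨_, .inl ⟨π, rfl⟩, subset_rfl⟩
  · exact ⟨_, .inr ⟨i, j, rfl⟩, h⟩
  · exact ⟨_, .inl ⟨π, rfl⟩, h⟩

/-! ### Signs and sums over a context -/

/-- The sign `(-1)^z`. -/
noncomputable def sgn (z : ZMod 2) : ℝ := (-1) ^ z.val

@[simp] theorem sgn_zero : sgn 0 = 1 := by simp [sgn]

@[simp] theorem sgn_one : sgn 1 = -1 := by
  have : (1 : ZMod 2).val = 1 := rfl
  simp [sgn, this]

theorem eq_zero_or_one (z : ZMod 2) : z = 0 ∨ z = 1 := by revert z; decide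

theorem sgn_eq (z : ZMod 2) : sgn z = 1 ∨ sgn z = -1 := by
  obtain rfl | rfl := eq_zero_or_one z <;> simp

theorem one_add_one_zmod : (1 : ZMod 2) + 1 = 0 := by decide

theorem sgn_add (x y : ZMod 2) : sgn (x + y) = sgn x * sgn y := by
  obtain rfl | rfl := eq_zero_or_one x <;> obtain rfl | rfl := eq_zero_or_one y <;>
    simp [one_add_one_zmod]

theorem sgn_injective : Function.Injective sgn := by
  intro x y h
  obtain rfl | rfl := eq_zero_or_one x <;> obtain rfl | rfl := eq_zero_or_one y <;>
    first | rfl | (exfalso; norm_num at h)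

theorem sgn_mul_self (z : ZMod 2) : sgn z * sgn z = 1 := by
  rcases sgn_eq z with h | h <;> simp [h]

@[simp] theorem abs_sgn (z : ZMod 2) : |sgn z| = 1 := by
  rcases sgn_eq z with h | h <;> simp [h]

theorem sum_zmod_two {R : Type*} [AddCommMonoid R] (f : ZMod 2 → R) :
    ∑ z, f z = f 0 + f 1 := Fin.sum_univ_two f

section Triple

variable {C : Ctx} {a b c : square.context C}

theorem univ_eq_triple (hab : a ≠ b) (hac : a ≠ c) (hbc : b ≠ c) :
    (Finset.univ : Finset (square.context C)) = {a, b, c} := by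
  refine (Finset.eq_univ_of_card _ ?_).symm
  rw [Finset.card_eq_three.2 ⟨a, b, c, hab, hac, hbc, rfl⟩, Fintype.card_coe, card_context]

theorem sum_context {R : Type*} [AddCommMonoid R] (hab : a ≠ b) (hac : a ≠ c) (hbc : b ≠ c)
    (f : square.context C → R) : ∑ x, f x = f a + f b + f c := by
  rw [univ_eq_triple hab hac hbc, Finset.sum_insert (by simp [hab, hac]),
    Finset.sum_pair hbc, add_assoc]

theorem eq_of_ne (hab : a ≠ b) (hac : a ≠ c) (hbc : b ≠ c) (x : square.context C) :
    x = a ∨ x = b ∨ x = c := by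
  have := Finset.mem_univ x
  rw [univ_eq_triple hab hac hbc] at this
  simpa using this

theorem exists_third (hab : a ≠ b) : ∃ c, a ≠ c ∧ b ≠ c := by
  have h : ({a, b} : Finset (square.context C)).card <
      (Finset.univ : Finset (square.context C)).card := by
    rw [Finset.card_pair hab, Finset.card_univ, Fintype.card_coe, card_context]; omega
  obtain ⟨c, -, hc⟩ := Finset.exists_mem_notMem_of_card_lt_card h
  simp only [Finset.mem_insert, Finset.mem_singleton, not_or] at hc
  exact ⟨c, Ne.symm hc.1, Ne.symm hc.2⟩

theorem exists_other_two (a : square.context C) : ∃ b c, a ≠ b ∧ a ≠ c ∧ b ≠ c := by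
  have : Nontrivial (square.context C) := by
    rw [← Fintype.one_lt_card_iff_nontrivial, Fintype.card_coe, card_context]; omega
  obtain ⟨b, hb⟩ := exists_ne a
  obtain ⟨c, hc⟩ := exists_third hb.symm
  exact ⟨b, c, hb.symm, hc⟩

/-- A sum over the functions on a context, in coordinates. -/
theorem sum_functions (hab : a ≠ b) (hac : a ≠ c) (hbc : b ≠ c)
    (F : ZMod 2 → ZMod 2 → ZMod 2 → ℝ) :
    ∑ s : square.context C → ZMod 2, F (s a) (s b) (s c) = ∑ x, ∑ y, ∑ z, F x y z := by
  have hbij : Function.Bijective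
      fun s : square.context C → ZMod 2 => (s a, s b, s c) := by
    rw [Fintype.bijective_iff_injective_and_card]
    refine ⟨fun s t h => ?_, ?_⟩
    · simp only [Prod.mk.injEq] at h
      funext x
      obtain rfl | rfl | rfl := eq_of_ne hab hac hbc x
      exacts [h.1, h.2.1, h.2.2]
    · simp [ZMod.card, card_context]
  rw [hbij.sum_comp (g := fun x : ZMod 2 × ZMod 2 × ZMod 2 => F x.1 x.2.1 x.2.2),
    Fintype.sum_prod_type]
  simp_rw [Fintype.sum_prod_type]

end Triple

/-- A nonzero `r` of even weight on three points has exactly two ones, so its signs sum to `-1`.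
This is the orthogonality relation behind the Fourier inversion. -/
theorem one_add_sum_sgn {C : Ctx} (r : square.context C → ZMod 2) (h : ∑ m, r m = 0) :
    1 + ∑ m, sgn (r m) = if r = 0 then 4 else 0 := by
  obtain ⟨a⟩ := nonempty_context C
  obtain ⟨b, c, hab, hac, hbc⟩ := exists_other_two a
  have h0 : r = 0 ↔ r a = 0 ∧ r b = 0 ∧ r c = 0 := by
    refine ⟨fun h => by simp [h], fun h => funext fun x => ?_⟩
    obtain rfl | rfl | rfl := eq_of_ne hab hac hbc x
    exacts [h.1, h.2.1, h.2.2]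
  rw [sum_context hab hac hbc] at h ⊢
  simp only [h0]
  generalize r a = x at *
  generalize r b = y at *
  generalize r c = z at *
  obtain rfl | rfl := eq_zero_or_one x <;> obtain rfl | rfl := eq_zero_or_one y <;>
    obtain rfl | rfl := eq_zero_or_one z <;> first | (exfalso; revert h; decide) | norm_num

/-! ### Coordinates on the Mermin polytopes -/

/-- The linear part of the inequality attached to `s : C → ℤ₂`. -/
noncomputable def form (C : Ctx) (s : square.context C → ZMod 2) (u : Meas → ℝ) : ℝ :=
  ∑ m, sgn (s m) * u m

theorem form_add (C : Ctx) (s : square.context C → ZMod 2) (u v : Meas → ℝ) :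
    form C s (u + v) = form C s u + form C s v := by
  simp [form, mul_add, Finset.sum_add_distrib]

theorem form_smul (C : Ctx) (s : square.context C → ZMod 2) (r : ℝ) (u : Meas → ℝ) :
    form C s (r • u) = r * form C s u := by
  simp only [form, Finset.mul_sum, Pi.smul_apply, smul_eq_mul]
  exact Finset.sum_congr rfl fun _ _ => by ring

/-- The Mermin polytope in the coordinates `u m = 2 p_m^0 - 1`. -/
def coordPolytope (β : Ctx → ZMod 2) : Set (Meas → ℝ) :=
  {u | ∀ C, ∀ s ∈ square.O β C, 0 ≤ 1 + form C s u}

/-- The family with coordinates `u`. -/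
noncomputable def ofCoords (β : Ctx → ZMod 2) (u : Meas → ℝ) : square.Family :=
  fun C s => if ∑ m, s m = β C then (1 + form C s u) / 4 else 0

/-- The coordinates `2 p_m^0 - 1` of a family. -/
noncomputable def coords (p : square.Family) (m : Meas) : ℝ :=
  2 * square.probZero p (.inl m.1) ⟨m, by simp⟩ - 1

theorem ofCoords_combo (β : Ctx → ZMod 2) (u v : Meas → ℝ) {r t : ℝ} (h : r + t = 1) :
    ofCoords β (r • u + t • v) = r • ofCoords β u + t • ofCoords β v := by
  funext C s
  simp only [ofCoords, Pi.add_apply, Pi.smul_apply, smul_eq_mul, form_add, form_smul]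
  split_ifs
  · linear_combination (-(1 : ℝ) / 4) * h
  · simp

/-- Fixing the value at `m` leaves two elements of `O_β(C)`, which differ at both other points; the
terms in `u b` and `u c` cancel. The result does not depend on `C`, whence nonsignaling. -/
theorem sum_filter_ofCoords (β : Ctx → ZMod 2) (u : Meas → ℝ) (C : Ctx) (m : square.context C)
    (w : ZMod 2) :
    ∑ s : square.context C → ZMod 2 with s m = w, ofCoords β u C s = (1 + sgn w * u m) / 2 := by
  obtain ⟨b, c, hab, hac, hbc⟩ := exists_other_two m
  rw [Finset.sum_filter]
  simp only [ofCoords, form, sum_context hab hac hbc]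
  rw [sum_functions hab hac hbc fun x y z => if x = w then
    (if x + y + z = β C then (1 + (sgn x * u m + sgn y * u b + sgn z * u c)) / 4 else 0) else 0]
  simp only [sum_zmod_two]
  generalize β C = d
  obtain rfl | rfl := eq_zero_or_one w <;> obtain rfl | rfl := eq_zero_or_one d <;>
    simp [one_add_one_zmod] <;> ring

theorem probZero_ofCoords (β : Ctx → ZMod 2) (u : Meas → ℝ) (C : Ctx) (m : square.context C) :
    square.probZero (ofCoords β u) C m = (1 + u m) / 2 := by
  rw [Scenario.probZero, sum_filter_ofCoords, sgn_zero, one_mul]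

theorem coords_ofCoords (β : Ctx → ZMod 2) (u : Meas → ℝ) : coords (ofCoords β u) = u := by
  funext m
  rw [coords, probZero_ofCoords]
  ring

theorem sum_ofCoords (β : Ctx → ZMod 2) (u : Meas → ℝ) (C : Ctx) :
    ∑ s, ofCoords β u C s = 1 := by
  obtain ⟨m⟩ := nonempty_context C
  rw [← Finset.sum_fiberwise _ fun s => s m, sum_zmod_two, sum_filter_ofCoords,
    sum_filter_ofCoords, sgn_zero, sgn_one]
  ring

/-! ### Nonsignaling families and their coordinates -/

theorem marginal_empty {C U : Finset Meas} (h : U ⊆ C) (hU : U = ∅) (q : (C → ZMod 2) → ℝ)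
    (t : U → ZMod 2) : marginal h q t = ∑ s, q s := by
  subst hU
  rw [marginal, Finset.filter_true_of_mem fun s _ => Subsingleton.elim _ _]

theorem marginal_singleton {C U : Finset Meas} (h : U ⊆ C) {m : Meas} (hU : U = {m})
    (q : (C → ZMod 2) → ℝ) (t : U → ZMod 2) (hm : m ∈ C) (hm' : m ∈ U) :
    marginal h q t = ∑ s : C → ZMod 2 with s ⟨m, hm⟩ = t ⟨m, hm'⟩, q s := by
  subst hU
  rw [marginal]
  congr 1
  refine Finset.filter_congr fun s _ => ⟨fun e => by rw [← e]; rfl, fun e => funext fun x => ?_⟩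
  obtain ⟨x, hx⟩ := x
  obtain rfl := Finset.mem_singleton.1 hx
  exact e

theorem context_inter (C C' : Ctx) (h : C ≠ C') :
    square.context C ∩ square.context C' = ∅ ∨
      ∃ m, square.context C ∩ square.context C' = {m} := by
  have : (square.context C ∩ square.context C').card ≤ 1 := by
    revert C C'; decide
  obtain h | h := Nat.le_one_iff_eq_zero_or_eq_one.1 this
  · exact .inl (Finset.card_eq_zero.1 h)
  · exact .inr (Finset.card_eq_one.1 h)

theorem ofCoords_mem_MP {β : Ctx → ZMod 2} {u : Meas → ℝ} (hu : u ∈ coordPolytope β) :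
    ofCoords β u ∈ MP β := by
  refine ⟨⟨fun C s => ?_, sum_ofCoords β u, fun C C' => ?_⟩, fun C s hs => ?_⟩
  · rw [ofCoords]
    split_ifs with h
    · have := hu C s h
      positivity
    · exact le_rfl
  · by_cases hC : C = C'
    · subst hC; rfl
    funext t
    obtain hU | ⟨m, hU⟩ := context_inter C C' hC
    · rw [marginal_empty _ hU, marginal_empty _ hU, sum_ofCoords, sum_ofCoords]
    · have hm : m ∈ square.context C ∩ square.context C' := by simp [hU]
      rw [marginal_singleton _ hU _ _ (Finset.mem_inter.1 hm).1 hm,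
        marginal_singleton _ hU _ _ (Finset.mem_inter.1 hm).2 hm,
        sum_filter_ofCoords, sum_filter_ofCoords]
  · by_contra h
    exact hs (if_neg h)

theorem probZero_eq_sum_marginal (p : square.Family) {C : Ctx} {U : Finset Meas}
    (h : U ⊆ square.context C) {m : Meas} (hm : m ∈ U) :
    square.probZero p C ⟨m, h hm⟩ = ∑ t : U → ZMod 2 with t ⟨m, hm⟩ = 0, marginal h (p C) t := by
  simp only [marginal, Scenario.probZero]
  rw [← Finset.sum_fiberwise_of_maps_to (s := Finset.univ.filter fun s => s ⟨m, h hm⟩ = 0)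
    (t := Finset.univ.filter fun t : U → ZMod 2 => t ⟨m, hm⟩ = 0)
    (g := Finset.restrict₂ (π := fun _ => ZMod 2) h) (by
      intro s hs
      simpa using hs)]
  refine Finset.sum_congr rfl fun t ht => ?_
  rw [Finset.filter_filter]
  refine Finset.sum_congr (Finset.filter_congr fun s _ => ?_) fun _ _ => rfl
  refine ⟨And.right, fun e => ⟨?_, e⟩⟩
  simp only [Finset.mem_filter, Finset.mem_univ, true_and] at ht
  rw [← ht, ← e]
  rfl

theorem probZero_eq_of_mem_NS {p : square.Family} (hp : p ∈ square.NS) {C C' : Ctx} {m : Meas}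
    (h : m ∈ square.context C) (h' : m ∈ square.context C') :
    square.probZero p C ⟨m, h⟩ = square.probZero p C' ⟨m, h'⟩ := by
  have hm : m ∈ square.context C ∩ square.context C' := Finset.mem_inter.2 ⟨h, h'⟩
  rw [probZero_eq_sum_marginal p Finset.inter_subset_left hm,
    probZero_eq_sum_marginal p Finset.inter_subset_right hm, hp.2.2 C C']

theorem coords_eq {p : square.Family} (hp : p ∈ square.NS) (C : Ctx) (m : square.context C) :
    coords p m = ∑ t, p C t * sgn (t m) := by
  rw [coords, probZero_eq_of_mem_NS hp _ m.2]
  have h1 := hp.2.1 C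
  have h : ∀ t : square.context C → ZMod 2,
      p C t * sgn (t m) = 2 * (if t m = 0 then p C t else 0) - p C t := fun t => by
    obtain h | h := eq_zero_or_one (t m)
    · simp [h]; ring
    · simp [h]
  simp only [h, Finset.sum_sub_distrib, ← Finset.mul_sum, h1, Scenario.probZero,
    Finset.sum_filter]

/-- Since `u m` is the expectation of `(-1)^{t(m)}` under `p_C`, the right side averages `1 + ∑
(-1)^{(s+t)(m)}` over `t`. For `s, t` in `O_β(C)` the sum `s + t` is even, so only `t = s`
contributes, with weight 4. -/
theorem four_mul_eq {β : Ctx → ZMod 2} {p : square.Family} (hp : p ∈ MP β) (C : Ctx)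
    (s : square.context C → ZMod 2) (hs : s ∈ square.O β C) :
    4 * p C s = 1 + form C s (coords p) := by
  have h1 : 1 + form C s (coords p) = ∑ t, p C t * (1 + ∑ m, sgn ((s + t) m)) := by
    simp only [form, coords_eq hp.1, mul_add, Finset.sum_add_distrib, mul_one, hp.1.2.1 C,
      Finset.mul_sum, Pi.add_apply, sgn_add]
    rw [Finset.sum_comm]
    congr 1
    exact Finset.sum_congr rfl fun _ _ => Finset.sum_congr rfl fun _ _ => by ring
  rw [h1, Finset.sum_eq_single s]
  · rw [one_add_sum_sgn _ (by simp [CharTwo.add_self_eq_zero]),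
      if_pos (by ext m; exact CharTwo.add_self_eq_zero (s m)), mul_comm]
  · intro t _ hts
    by_cases ht : p C t = 0
    · simp [ht]
    · have hO : ∑ m, t m = β C := hp.2 C ht
      have hO' : ∑ m, s m = β C := hs
      rw [one_add_sum_sgn, if_neg, mul_zero]
      · intro h
        exact hts (funext fun m => (CharTwo.add_eq_zero.1 (congrFun h m)).symm)
      · simp only [Pi.add_apply, Finset.sum_add_distrib]
        rw [hO, hO', CharTwo.add_self_eq_zero]
  · simp

theorem coords_mem {β : Ctx → ZMod 2} {p : square.Family} (hp : p ∈ MP β) :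
    coords p ∈ coordPolytope β := fun C s hs => by
  rw [← four_mul_eq hp C s hs]
  have := hp.1.1 C s
  positivity

theorem ofCoords_coords {β : Ctx → ZMod 2} {p : square.Family} (hp : p ∈ MP β) :
    ofCoords β (coords p) = p := by
  funext C s
  rw [ofCoords]
  split_ifs with h
  · rw [← four_mul_eq hp C s h]; ring
  · by_contra hne
    exact h (hp.2 C (Ne.symm hne))

theorem ofCoords_injective (β : Ctx → ZMod 2) : Function.Injective (ofCoords β) :=
  Function.LeftInverse.injective (coords_ofCoords β)

/-- `ofCoords β` and `coords` are mutually inverse between the two polytopes, and `ofCoords β`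
respects convex combinations. -/
theorem ofCoords_mem_vertices_iff {β : Ctx → ZMod 2} {u : Meas → ℝ} :
    ofCoords β u ∈ vertices β ↔ u ∈ (coordPolytope β).extremePoints ℝ := by
  rw [vertices, mem_extremePoints_iff_left, mem_extremePoints_iff_left]
  constructor
  · rintro ⟨h, hext⟩
    refine ⟨coords_ofCoords β u ▸ coords_mem h, fun v hv w hw hs => ?_⟩
    obtain ⟨r, t, hr, ht, hrt, rfl⟩ := hs
    exact ofCoords_injective β (hext _ (ofCoords_mem_MP hv) _ (ofCoords_mem_MP hw)
      ⟨r, t, hr, ht, hrt, (ofCoords_combo β v w hrt).symm⟩)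
  · rintro ⟨h, hext⟩
    refine ⟨ofCoords_mem_MP h, fun p hp q hq hs => ?_⟩
    obtain ⟨r, t, hr, ht, hrt, he⟩ := hs
    rw [← ofCoords_coords hp, ← ofCoords_coords hq, ← ofCoords_combo β _ _ hrt] at he
    rw [← hext _ (coords_mem hp) _ (coords_mem hq) ⟨r, t, hr, ht, hrt, ofCoords_injective β he⟩,
      ofCoords_coords hp]

/-- The coordinates prescribed by `s : Ω → ℤ₂`. -/
noncomputable def vec (Ω : Finset Meas) (s : Ω → ZMod 2) (m : Meas) : ℝ :=
  if h : m ∈ Ω then sgn (s ⟨m, h⟩) else 0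

theorem hasMarginals_ofCoords_iff {β : Ctx → ZMod 2} {u : Meas → ℝ} {Ω : Finset Meas}
    {s : Ω → ZMod 2} : square.HasMarginals (ofCoords β u) Ω s ↔ u = vec Ω s := by
  have key : ∀ m, ((1 + u m) / 2 =
      if h : m ∈ Ω then (1 + (-1 : ℝ) ^ (s ⟨m, h⟩).val) / 2 else 1 / 2) ↔ u m = vec Ω s m := by
    intro m
    rw [vec]
    split_ifs with h
    · change (1 + u m) / 2 = (1 + sgn (s ⟨m, h⟩)) / 2 ↔ _
      constructor <;> intro h <;> linarith
    · constructor <;> intro h <;> linarith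
  simp only [Scenario.HasMarginals, probZero_ofCoords]
  constructor
  · intro h
    funext m
    exact (key m).1 (h (.inl m.1) ⟨m, by simp⟩)
  · intro h C m
    exact (key m).2 (congrFun h m)

theorem hasMarginals_iff {β : Ctx → ZMod 2} {p : square.Family} (hp : p ∈ MP β) {Ω : Finset Meas}
    {s : Ω → ZMod 2} : square.HasMarginals p Ω s ↔ p = ofCoords β (vec Ω s) := by
  rw [← ofCoords_coords hp, hasMarginals_ofCoords_iff, (ofCoords_injective β).eq_iff]

/-! ### Extreme points in coordinates -/

section Inequalities

variable {β : Ctx → ZMod 2} {u : Meas → ℝ} {C : Ctx} {a b c : square.context C}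

theorem exists_mem_O (β : Ctx → ZMod 2) (hab : a ≠ b) (hac : a ≠ c) (hbc : b ≠ c)
    (z w : ZMod 2) :
    ∃ s ∈ square.O β C, s a = z ∧ s b = w ∧ s c = β C + z + w := by
  refine ⟨fun x => if x = a then z else if x = b then w else β C + z + w, ?_, by simp,
    by simp [hab.symm], by simp [hac.symm, hbc.symm]⟩
  simp only [Scenario.O, Set.mem_ofPred_eq]
  rw [sum_context hab hac hbc]
  simp only [if_true, if_neg hab.symm, if_neg hac.symm, if_neg hbc.symm]
  generalize β C = d
  revert d z w; decide

theorem form_eq (hab : a ≠ b) (hac : a ≠ c) (hbc : b ≠ c) (s : square.context C → ZMod 2)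
    (u : Meas → ℝ) : form C s u = sgn (s a) * u a + sgn (s b) * u b + sgn (s c) * u c :=
  sum_context hab hac hbc _

theorem coord_ineq (hu : u ∈ coordPolytope β) (hab : a ≠ b) (hac : a ≠ c) (hbc : b ≠ c)
    (z w : ZMod 2) : 0 ≤ 1 + sgn z * u a + sgn w * (u b + sgn (β C + z) * u c) := by
  obtain ⟨s, hs, rfl, rfl, hc⟩ := exists_mem_O β hab hac hbc z w
  have := hu C s hs
  rw [form_eq hab hac hbc, hc, sgn_add] at this
  linarith

theorem abs_coord_le_one (hu : u ∈ coordPolytope β) (m : Meas) : |u m| ≤ 1 := by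
  obtain ⟨b, c, hab, hac, hbc⟩ := exists_other_two (C := .inl m.1) ⟨m, by simp⟩
  have h : ∀ z w, _ := coord_ineq hu hab hac hbc
  have h1 := h 0 0
  have h2 := h 0 1
  have h3 := h 1 0
  have h4 := h 1 1
  simp only [sgn_zero, sgn_one] at h1 h2 h3 h4
  rw [abs_le]
  constructor <;> linarith

/-- If one coordinate of a context is `±1`, the two others agree up to a prescribed sign. -/
theorem coord_eq_of_eq_sgn (hu : u ∈ coordPolytope β) (hab : a ≠ b) (hac : a ≠ c) (hbc : b ≠ c)
    {z : ZMod 2} (ha : u a = sgn z) : u b = sgn (β C + z) * u c := by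
  -- With the value opposite to `z` at `a`, the first two terms cancel; the two choices of `w` give
  -- both signs of the remaining difference.
  have h := coord_ineq hu hab hac hbc (z + 1)
  have h0 := h 0
  have h1 := h 1
  simp only [ha, ← add_assoc, sgn_add _ (1 : ZMod 2), sgn_one, sgn_zero] at h0 h1
  have := sgn_mul_self z
  linarith

theorem abs_coord_eq (hu : u ∈ coordPolytope β) (hab : a ≠ b) (hac : a ≠ c) (hbc : b ≠ c)
    {z : ZMod 2} (ha : u a = sgn z) : |u b| = |u c| := by
  rw [coord_eq_of_eq_sgn hu hab hac hbc ha, abs_mul, abs_sgn, one_mul]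

end Inequalities

/-- The sign of the coordinates, as a function to `ℤ₂`. -/
noncomputable def signOf (u : Meas → ℝ) (m : Meas) : ZMod 2 := if 0 ≤ u m then 0 else 1

theorem abs_mul_sgn_signOf (u : Meas → ℝ) (m : Meas) : |u m| * sgn (signOf u m) = u m := by
  rw [signOf]
  split_ifs with h
  · simp [abs_of_nonneg h]
  · simp [abs_of_neg (not_le.1 h)]

theorem sgn_signOf {u : Meas → ℝ} {m : Meas} (h : |u m| = 1) : u m = sgn (signOf u m) := by
  have := abs_mul_sgn_signOf u m
  rw [h, one_mul] at this
  exact this.symm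

/-- The measurements with deterministic outcome. -/
noncomputable def detSet (u : Meas → ℝ) : Finset Meas :=
  Finset.univ.filter fun m => |u m| = 1

@[simp] theorem mem_detSet {u : Meas → ℝ} {m : Meas} : m ∈ detSet u ↔ |u m| = 1 := by
  simp [detSet]

/-- The common absolute value cancels from `u b = ± u c`, leaving an identity of signs. Nonvanishing
is needed because `signOf` is arbitrary at zero. -/
theorem sum_signOf {β : Ctx → ZMod 2} {u : Meas → ℝ} (hu : u ∈ coordPolytope β) {C : Ctx}
    {a : square.context C} (ha : |u a| = 1) (hpos : ∀ m : square.context C, u m ≠ 0) :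
    ∑ m : square.context C, signOf u m = β C := by
  obtain ⟨b, c, hab, hac, hbc⟩ := exists_other_two a
  have h := coord_eq_of_eq_sgn hu hab hac hbc (sgn_signOf ha)
  have habs := abs_coord_eq hu hab hac hbc (sgn_signOf ha)
  rw [← abs_mul_sgn_signOf u b, ← abs_mul_sgn_signOf u c, habs, mul_left_comm, ← sgn_add] at h
  have h' := sgn_injective (mul_left_cancel₀ (abs_ne_zero.2 (hpos c)) h)
  rw [sum_context hab hac hbc, h']
  generalize signOf u a = x
  generalize signOf u c = y
  generalize β C = d
  revert x y d; decide

theorem isClosed_detSet {β : Ctx → ZMod 2} {u : Meas → ℝ} (hu : u ∈ coordPolytope β) :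
    square.IsClosed (detSet u) := by
  intro C a ha b hb hab m hm
  rw [Finset.mem_inter, mem_detSet] at ha hb
  rw [mem_detSet]
  by_cases hma : m = a
  · rw [hma]; exact ha.2
  by_cases hmb : m = b
  · rw [hmb]; exact hb.2
  have := abs_coord_eq (C := C) (a := ⟨a, ha.1⟩) (b := ⟨b, hb.1⟩) (c := ⟨m, hm⟩) hu
    (by simpa using hab) (by simpa using Ne.symm hma) (by simpa using Ne.symm hmb)
    (sgn_signOf ha.2)
  rw [← this]
  exact hb.2

theorem isOutcomeAssignment_detSet {β : Ctx → ZMod 2} {u : Meas → ℝ} (hu : u ∈ coordPolytope β) :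
    square.IsOutcomeAssignment β (detSet u) fun m => signOf u m := by
  intro C hC
  have h1 : ∀ m : square.context C, |u m| = 1 := fun m => mem_detSet.1 (hC m.2)
  obtain ⟨a⟩ := nonempty_context C
  exact sum_signOf hu (h1 a) fun m h => by simpa [h] using h1 m

/-- Outcome assignments on the whole square. -/
def IsGlobal (β : Ctx → ZMod 2) (t : Meas → ZMod 2) : Prop :=
  ∀ C, ∑ m : square.context C, t m = β C

/-- Crosses and transversals determine the remaining coordinates in the contextual case. -/
theorem IsBig.eq_zero_of_notMem {β : Ctx → ZMod 2} (hβ : ¬ ∃ t, IsGlobal β t) {Ω : Finset Meas}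
    (hΩ : IsBig Ω) {u : Meas → ℝ} (hu : u ∈ coordPolytope β) (h : ∀ m ∈ Ω, |u m| = 1)
    {x : Meas} (hx : x ∉ Ω) : u x = 0 := by
  by_contra hne
  have hcol : ∀ y z, y ∉ Ω → z ∉ Ω → Collinear y z → |u y| = |u z| := by
    intro y z hy hz hyz
    by_cases heq : y = z
    · rw [heq]
    obtain ⟨C, hyC, hzC⟩ := collinear_iff.1 hyz
    obtain ⟨a, haC, ha⟩ := hΩ.exists_mem_context C
    exact abs_coord_eq (C := C) (a := ⟨a, haC⟩) (b := ⟨y, hyC⟩) (c := ⟨z, hzC⟩) hu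
      (by simpa using fun e : a = y => hy (e ▸ ha)) (by simpa using fun e : a = z => hz (e ▸ ha))
      (by simpa using heq) (sgn_signOf (h a ha))
  have hall : ∀ y, u y ≠ 0 := by
    intro y
    by_cases hy : y ∈ Ω
    · intro h0
      simpa [h0] using h y hy
    · obtain ⟨v, hv, w, hw, h1, h2, h3⟩ := hΩ.exists_path hx hy
      rw [← abs_ne_zero, ← hcol w y hw hy h3, ← hcol v w hv hw h2, ← hcol x v hx hv h1]
      exact abs_ne_zero.2 hne
  -- Every coordinate is nonzero and every context has a deterministic one, so the signs form a
  -- global assignment.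
  refine hβ ⟨signOf u, fun C => ?_⟩
  obtain ⟨a, haC, ha⟩ := hΩ.exists_mem_context C
  exact sum_signOf hu (a := ⟨a, haC⟩) (h a ha) fun m => hall m

theorem vec_of_mem {Ω : Finset Meas} {s : Ω → ZMod 2} {m : Meas} (h : m ∈ Ω) :
    vec Ω s m = sgn (s ⟨m, h⟩) := dif_pos h

theorem vec_of_notMem {Ω : Finset Meas} {s : Ω → ZMod 2} {m : Meas} (h : m ∉ Ω) :
    vec Ω s m = 0 := dif_neg h

theorem abs_vec_le_one (Ω : Finset Meas) (s : Ω → ZMod 2) (m : Meas) : |vec Ω s m| ≤ 1 := by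
  rw [vec]
  split_ifs <;> simp

theorem detSet_vec (Ω : Finset Meas) (s : Ω → ZMod 2) : detSet (vec Ω s) = Ω := by
  ext m
  rw [mem_detSet, vec]
  split_ifs with h <;> simp [h]

theorem neg_one_le_sgn_mul {x : ℝ} (hx : |x| ≤ 1) (z : ZMod 2) : -1 ≤ sgn z * x := by
  have := neg_abs_le (sgn z * x)
  rw [abs_mul, abs_sgn, one_mul] at this
  linarith

/-- On a context inside `Ω` the form is that of a deterministic point. On any other context
closedness leaves at most one nonzero coordinate, of absolute value 1. -/
theorem vec_mem {β : Ctx → ZMod 2} {Ω : Finset Meas} (hΩ : square.IsClosed Ω) {s : Ω → ZMod 2}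
    (hs : square.IsOutcomeAssignment β Ω s) : vec Ω s ∈ coordPolytope β := by
  intro C r hr
  by_cases hC : square.context C ⊆ Ω
  · have hr' : ∑ m, r m = β C := hr
    have hs' : ∑ m : square.context C, s ⟨m, hC m.2⟩ = β C := hs C hC
    have h := one_add_sum_sgn (r + fun m : square.context C => s ⟨m, hC m.2⟩) (by
      simp only [Pi.add_apply, Finset.sum_add_distrib]
      rw [hr', hs', CharTwo.add_self_eq_zero])
    have he : form C r (vec Ω s) = ∑ m, sgn ((r + fun m : square.context C => s ⟨m, hC m.2⟩) m) :=
      Finset.sum_congr rfl fun m _ => by rw [vec_of_mem (hC m.2), Pi.add_apply, sgn_add]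
    rw [he, h]
    split_ifs <;> norm_num
  · obtain ⟨x, hxC, hx⟩ := Finset.not_subset.1 hC
    obtain ⟨b, c, hxb, hxc, hbc⟩ := exists_other_two (C := C) ⟨x, hxC⟩
    rw [form_eq hxb hxc hbc, vec_of_notMem hx]
    have hb := neg_one_le_sgn_mul (abs_vec_le_one Ω s b) (r b)
    have hc := neg_one_le_sgn_mul (abs_vec_le_one Ω s c) (r c)
    by_cases hbΩ : (b : Meas) ∈ Ω
    · have hcΩ : (c : Meas) ∉ Ω := fun hcΩ =>
        hC (hΩ C b (Finset.mem_inter.2 ⟨b.2, hbΩ⟩) c (Finset.mem_inter.2 ⟨c.2, hcΩ⟩)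
          fun e => hbc (Subtype.ext e))
      rw [vec_of_notMem hcΩ]
      linarith
    · rw [vec_of_notMem hbΩ]
      linarith

/-- All coordinates lie in `[-1, 1]`, so a coordinate equal to `±1` is shared by both endpoints of
any segment through the point; `huniq` handles the rest. -/
theorem vec_mem_extremePoints {β : Ctx → ZMod 2} {Ω : Finset Meas} {s : Ω → ZMod 2}
    (hmem : vec Ω s ∈ coordPolytope β)
    (huniq : ∀ v ∈ coordPolytope β, (∀ m ∈ Ω, v m = vec Ω s m) → v = vec Ω s) :
    vec Ω s ∈ (coordPolytope β).extremePoints ℝ := by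
  rw [mem_extremePoints_iff_left]
  refine ⟨hmem, fun y hy z hz hyz => huniq y hy fun m hm => ?_⟩
  obtain ⟨r, t, hr, ht, hrt, he⟩ := hyz
  have hm' : r * y m + t * z m = vec Ω s m := congrFun he m
  have hym := abs_le.1 (abs_coord_le_one hy m)
  have hzm := abs_le.1 (abs_coord_le_one hz m)
  rw [vec_of_mem hm] at hm' ⊢
  rcases sgn_eq (s ⟨m, hm⟩) with h | h <;> rw [h] at hm' ⊢ <;> nlinarith

/-- At an extreme point the tight inequalities have no common nonzero direction. -/
theorem eq_zero_of_tight {β : Ctx → ZMod 2} {u : Meas → ℝ}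
    (hu : u ∈ (coordPolytope β).extremePoints ℝ) {d : Meas → ℝ}
    (hd : ∀ C, ∀ s ∈ square.O β C, 1 + form C s u = 0 → form C s d = 0) : d = 0 := by
  rw [mem_extremePoints_iff_left] at hu
  -- Tight inequalities are unaffected by moving along `d`, and the finitely many slack ones survive
  -- for small `ε > 0`. Then `u` is the midpoint of `u ± ε d`.
  have hev : ∀ᶠ ε in nhdsWithin (0 : ℝ) (Set.Ioi 0), ∀ C s, s ∈ square.O β C →
      0 ≤ 1 + form C s u + ε * form C s d ∧ 0 ≤ 1 + form C s u + -ε * form C s d := by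
    refine Filter.eventually_all.2 fun C => Filter.eventually_all.2 fun s => ?_
    by_cases hs : s ∈ square.O β C
    · by_cases ht : 1 + form C s u = 0
      · exact Filter.Eventually.of_forall fun ε _ => by simp [hd C s hs ht, ht]
      · have hpos : 0 < 1 + form C s u := lt_of_le_of_ne (hu.1 C s hs) (Ne.symm ht)
        have h1 : Filter.Tendsto (fun ε : ℝ => 1 + form C s u + ε * form C s d) (nhds 0)
            (nhds (1 + form C s u + 0 * form C s d)) := Continuous.tendsto (by fun_prop) 0
        have h2 : Filter.Tendsto (fun ε : ℝ => 1 + form C s u + -ε * form C s d) (nhds 0)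
            (nhds (1 + form C s u + -0 * form C s d)) := Continuous.tendsto (by fun_prop) 0
        filter_upwards [nhdsWithin_le_nhds (h1.eventually (lt_mem_nhds (by simpa using hpos))),
          nhdsWithin_le_nhds (h2.eventually (lt_mem_nhds (by simpa using hpos)))] with ε e1 e2 _
        exact ⟨le_of_lt e1, le_of_lt e2⟩
    · exact Filter.Eventually.of_forall fun ε h => absurd h hs
  obtain ⟨ε, hε, hpos⟩ := (hev.and self_mem_nhdsWithin).exists
  have hpos : 0 < ε := hpos
  have h1 : u + ε • d ∈ coordPolytope β := fun C s hs => by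
    rw [form_add, form_smul, ← add_assoc]; exact (hε C s hs).1
  have h2 : u + (-ε) • d ∈ coordPolytope β := fun C s hs => by
    rw [form_add, form_smul, ← add_assoc]; exact (hε C s hs).2
  have h3 := hu.2 _ h1 _ h2 ⟨1 / 2, 1 / 2, by norm_num, by norm_num, by norm_num, by
    funext m; simp; ring⟩
  have h4 : ε • d = 0 := by simpa using h3
  exact (smul_eq_zero.1 h4).resolve_left hpos.ne'

/-- Equal parity on three points means that distinct assignments differ in exactly two places. -/
theorem exists_agree {β : Ctx → ZMod 2} {C : Ctx} {s s' : square.context C → ZMod 2}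
    (hs : s ∈ square.O β C) (hs' : s' ∈ square.O β C) (hne : s ≠ s') :
    ∃ a b c, a ≠ b ∧ a ≠ c ∧ b ≠ c ∧ s' a = s a ∧ s' b = s b + 1 ∧ s' c = s c + 1 := by
  obtain ⟨b, hb⟩ := Function.ne_iff.1 hne
  obtain ⟨a, c, hba, hbc, hac⟩ := exists_other_two b
  have h : ∑ m, s m = ∑ m, s' m := Eq.trans hs (Eq.symm hs')
  rw [sum_context hba hbc hac, sum_context hba hbc hac] at h
  have key : ∀ x y z x' y' z' : ZMod 2, x ≠ x' → x + y + z = x' + y' + z' →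
      x' = x + 1 ∧ (y' = y ∧ z' = z + 1 ∨ z' = z ∧ y' = y + 1) := by decide
  obtain ⟨h1, ⟨h2, h3⟩ | ⟨h2, h3⟩⟩ := key _ _ _ _ _ _ hb h
  · exact ⟨a, b, c, hba.symm, hac, hbc, h2, h1, h3⟩
  · exact ⟨c, b, a, hbc.symm, hac.symm, hba, h2, h1, h3⟩

/-- `form` as a linear map. -/
noncomputable def formLinear (C : Ctx) (s : square.context C → ZMod 2) : (Meas → ℝ) →ₗ[ℝ] ℝ where
  toFun := form C s
  map_add' := form_add C s
  map_smul' := form_smul C s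

theorem nine_le_of_extreme {β : Ctx → ZMod 2} {u : Meas → ℝ}
    (hu : u ∈ (coordPolytope β).extremePoints ℝ) :
    9 ≤ (detSet u).card +
      (Finset.univ.filter fun C => ¬ square.context C ⊆ detSet u).card := by
  have hex : ∀ C, ∃ s, ∀ s' ∈ square.O β C, 1 + form C s' u = 0 →
      s ∈ square.O β C ∧ 1 + form C s u = 0 := by
    intro C
    by_cases h : ∃ s ∈ square.O β C, 1 + form C s u = 0
    · obtain ⟨s, hs⟩ := h
      exact ⟨s, fun _ _ _ => hs⟩
    -- Without a tight inequality on `C` the chosen `s` plays no role.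
    · exact ⟨0, fun s' h1 h2 => absurd ⟨s', h1, h2⟩ h⟩
  choose s hs using hex
  by_contra! hlt
  -- One equation per deterministic coordinate and one per context not inside `detSet u`. With fewer
  -- than nine equations a nonzero `d` solves them all, and it remains to see that `d` respects
  -- every tight inequality.
  let L : (Meas → ℝ) →ₗ[ℝ] (detSet u ⊕ {C // ¬ square.context C ⊆ detSet u} → ℝ) :=
    LinearMap.pi (Sum.elim (fun m => LinearMap.proj m.1) fun C => formLinear C.1 (s C.1))
  have hker : LinearMap.ker L ≠ ⊥ := by
    apply LinearMap.ker_ne_bot_of_finrank_lt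
    rw [Module.finrank_fintype_fun_eq_card, Module.finrank_fintype_fun_eq_card, Fintype.card_sum,
      Fintype.card_coe, Fintype.card_subtype]
    exact hlt
  obtain ⟨d, hd, hd0⟩ := (Submodule.ne_bot_iff _).1 hker
  have hL : ∀ x, L d x = 0 := fun x => congrFun (LinearMap.mem_ker.1 hd) x
  have hE : ∀ m, |u m| = 1 → d m = 0 := fun m hm => hL (.inl ⟨m, mem_detSet.2 hm⟩)
  refine hd0 (eq_zero_of_tight hu fun C r hr ht => ?_)
  by_cases hC : square.context C ⊆ detSet u
  · exact Finset.sum_eq_zero fun m _ => by rw [hE m (mem_detSet.1 (hC m.2)), mul_zero]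
  · have h0 : form C (s C) d = 0 := hL (.inr ⟨C, hC⟩)
    obtain ⟨hsO, hst⟩ := hs C r hr ht
    by_cases hne : s C = r
    · rw [← hne, h0]
    obtain ⟨a, b, c, hab, hac, hbc, ha, hb, hc⟩ := exists_agree hsO hr hne
    rw [form_eq hab hac hbc] at h0 hst ht ⊢
    rw [ha, hb, hc, sgn_add, sgn_add, sgn_one] at ht ⊢
    -- Adding the two tight equations cancels `b` and `c`. So `a` is deterministic, `d a = 0`, and
    -- on `d` the second form is the negative of the first.
    have hua : sgn (s C a) * u a = -1 := by linarith
    have hda : d a = 0 := hE a (by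
      have := congrArg abs hua
      rwa [abs_mul, abs_sgn, one_mul, abs_neg, abs_one] at this)
    rw [hda] at h0 ⊢
    linarith

theorem detSet_of_extreme {β : Ctx → ZMod 2} {u : Meas → ℝ}
    (hu : u ∈ (coordPolytope β).extremePoints ℝ) :
    IsBig (detSet u) ∨ detSet u = Finset.univ := by
  have h9 := nine_le_of_extreme hu
  obtain h | h | h | ⟨⟨h, -⟩, -⟩ := isClosed_classification (isClosed_detSet hu.1)
  · exact .inr h
  · exact .inl (.inr h)
  · exact .inl (.inl h)
  · omega

/-- An assignment on a cross or a transversal that extends to the whole square does not come from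
an extreme point. -/
theorem IsBig.not_extreme {β : Ctx → ZMod 2} {u : Meas → ℝ} (hE : IsBig (detSet u))
    {t : Meas → ZMod 2} (ht : IsGlobal β t) (htu : ∀ m ∈ detSet u, u m = sgn (t m)) :
    u ∉ (coordPolytope β).extremePoints ℝ := by
  intro hu
  have hd : (fun m => if m ∈ detSet u then 0 else sgn (t m)) = (0 : Meas → ℝ) := by
    refine eq_zero_of_tight hu fun C s hs hs0 => ?_
    by_cases hC : square.context C ⊆ detSet u
    · exact Finset.sum_eq_zero fun m _ => by simp only [if_pos (hC m.2), mul_zero]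
    obtain ⟨a, haC, ha⟩ := hE.exists_mem_context C
    obtain ⟨b, hbC, hb⟩ := Finset.not_subset.1 hC
    have hab : (⟨a, haC⟩ : square.context C) ≠ ⟨b, hbC⟩ := by
      simpa using fun e : a = b => hb (e ▸ ha)
    obtain ⟨c, hac, hbc⟩ := exists_third hab
    have hc : (c : Meas) ∉ detSet u := fun hc =>
      hC (hE.isClosed C a (Finset.mem_inter.2 ⟨haC, ha⟩) c (Finset.mem_inter.2 ⟨c.2, hc⟩)
        fun e => hac (Subtype.ext e))
    have hsum : ∑ m, s m = ∑ m : square.context C, t m := Eq.trans hs (ht C).symm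
    rw [sum_context hab hac hbc, sum_context hab hac hbc] at hsum
    rw [form_eq hab hac hbc] at hs0 ⊢
    simp only [if_pos ha, if_neg hb, if_neg hc, mul_zero, zero_add]
    have hb' := neg_one_le_sgn_mul (abs_coord_le_one hu.1 b) (s ⟨b, hbC⟩)
    have hc' := neg_one_le_sgn_mul (abs_coord_le_one hu.1 c) (s c)
    -- If `s` and `t` agreed at `a`, tightness would force the terms at `b` and `c` to be `-1`,
    -- making `b` deterministic.
    have hne : s ⟨a, haC⟩ ≠ t a := by
      intro e
      rw [e, htu a ha, sgn_mul_self] at hs0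
      have h1 : sgn (s ⟨b, hbC⟩) * u b = -1 := by linarith
      have := congrArg abs h1
      rw [abs_mul, abs_sgn, one_mul, abs_neg, abs_one] at this
      exact hb (mem_detSet.2 this)
    -- As `s` and `t` have equal parity and differ at `a`, they differ at exactly one of `b` and
    -- `c`; the two remaining terms cancel.
    have key : ∀ x y z x' y' z' : ZMod 2, x ≠ x' → x + y + z = x' + y' + z' →
        y + y' = z + z' + 1 := by decide
    have h1 := key _ _ _ _ _ _ hne hsum
    rw [← sgn_add, ← sgn_add, h1, sgn_add, sgn_one]
    ring
  obtain ⟨m, hm⟩ : ∃ m, m ∉ detSet u := by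
    by_contra! hcon
    exact hE.ne_univ (Finset.eq_univ_of_forall hcon)
  have := congrFun hd m
  simp only [if_neg hm, Pi.zero_apply] at this
  rcases sgn_eq (t m) with h | h <;> rw [h] at this <;> norm_num at this

/-! ### Global assignments and homomorphisms -/

theorem sum_context_inl {R : Type*} [AddCommMonoid R] (i : Fin 3) (f : Meas → R) :
    ∑ m : square.context (.inl i), f m = ∑ j, f (i, j) := by
  rw [Finset.sum_coe_sort (square.context (.inl i)) f]
  exact Finset.sum_image fun a _ b _ h => congrArg Prod.snd h

theorem sum_context_inr {R : Type*} [AddCommMonoid R] (j : Fin 3) (f : Meas → R) :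
    ∑ m : square.context (.inr j), f m = ∑ i, f (i, j) := by
  rw [Finset.sum_coe_sort (square.context (.inr j)) f]
  exact Finset.sum_image fun a _ b _ h => congrArg Prod.fst h

/-- Summing all nine values by rows gives 0, by columns 3 = 1. -/
theorem not_exists_isGlobal_β₁ : ¬ ∃ t, IsGlobal β₁ t := by
  rintro ⟨t, ht⟩
  have h1 : ∀ i, ∑ j, t (i, j) = 0 := fun i => by rw [← sum_context_inl]; exact ht (.inl i)
  have h2 : ∀ j, ∑ i, t (i, j) = 1 := fun j => by rw [← sum_context_inr]; exact ht (.inr j)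
  have h3 : ∑ i, ∑ j, t (i, j) = ∑ j, ∑ i, t (i, j) := Finset.sum_comm
  simp only [h1, h2] at h3
  revert h3
  decide

theorem isHom_iff (s : Meas → ZMod 2) : IsHom s ↔ IsGlobal β₀ s := by
  constructor
  · intro h C
    obtain ⟨a⟩ := nonempty_context C
    obtain ⟨b, c, hab, hac, hbc⟩ := exists_other_two a
    have hC : square.context C = {a.1, b.1, c.1} := by
      ext m
      simp only [Finset.mem_insert, Finset.mem_singleton]
      constructor
      · intro hm
        simpa only [Subtype.ext_iff] using eq_of_ne hab hac hbc ⟨m, hm⟩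
      · rintro (rfl | rfl | rfl) <;> exact Subtype.prop _
    rw [sum_context hab hac hbc, h C a b c hC]
    exact CharTwo.add_self_eq_zero _
  · intro h C a b c hC
    have hcard := card_context C
    rw [hC] at hcard
    have hab : a ≠ b := by
      rintro rfl
      have := Finset.card_le_two (a := a) (b := c)
      simp only [Finset.insert_idem] at hcard
      omega
    have hac : a ≠ c := by
      rintro rfl
      have := Finset.card_le_two (a := b) (b := a)
      rw [Finset.insert_eq_of_mem (by simp)] at hcard
      omega
    have hbc : b ≠ c := by
      rintro rfl
      have := Finset.card_le_two (a := a) (b := b)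
      simp only [Finset.insert_eq_of_mem, Finset.mem_singleton] at hcard
      omega
    have h0 : ∑ m : square.context C, s m = 0 := h C
    rw [sum_context (a := ⟨a, by simp [hC]⟩) (b := ⟨b, by simp [hC]⟩) (c := ⟨c, by simp [hC]⟩)
      (by simpa using hab) (by simpa using hac) (by simpa using hbc)] at h0
    exact (CharTwo.add_eq_zero.1 h0).symm

/-- The homomorphism with given values on the corner. -/
def homOfCorner (a b c d : ZMod 2) (m : Meas) : ZMod 2 :=
  ![![a, b, a + b], ![c, d, c + d], ![a + c, b + d, a + b + (c + d)]] m.1 m.2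

theorem isGlobal_homOfCorner (a b c d : ZMod 2) : IsGlobal β₀ (homOfCorner a b c d) := by
  rintro (i | j)
  · rw [sum_context_inl]
    revert a b c d i; decide +kernel
  · rw [sum_context_inr]
    revert a b c d j; decide +kernel

theorem isGlobal_β₀_iff {t : Meas → ZMod 2} : IsGlobal β₀ t ↔
    (∀ i, t (i, 0) + t (i, 1) + t (i, 2) = 0) ∧ ∀ j, t (0, j) + t (1, j) + t (2, j) = 0 := by
  rw [IsGlobal, Sum.forall]
  simp only [sum_context_inl, sum_context_inr, Fin.sum_univ_three, β₀]

/-- In the even case an outcome assignment on a cross or a transversal extends to the square. -/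
theorem IsBig.exists_extension {Ω : Finset Meas} (hΩ : IsBig Ω) {s : Meas → ZMod 2}
    (hs : square.IsOutcomeAssignment β₀ Ω fun m => s m) :
    ∃ t, IsGlobal β₀ t ∧ ∀ m ∈ Ω, t m = s m := by
  obtain ⟨π, rfl⟩ | ⟨i, j, rfl⟩ := hΩ
  · have key : ∀ π : Equiv.Perm (Fin 3), ∀ x y z, ∃ a b c d,
        homOfCorner a b c d (0, π 0) = x ∧ homOfCorner a b c d (1, π 1) = y ∧
          homOfCorner a b c d (2, π 2) = z := by decide +kernel
    obtain ⟨a, b, c, d, h0, h1, h2⟩ := key π (s (0, π 0)) (s (1, π 1)) (s (2, π 2))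
    refine ⟨_, isGlobal_homOfCorner a b c d, fun m hm => ?_⟩
    obtain ⟨k, l⟩ := m
    obtain rfl : π k = l := by simpa using hm
    fin_cases k
    exacts [h0, h1, h2]
  -- It suffices to match the centre and one point on each arm; the row and column sums force the
  -- other two.
  · have key : ∀ i j : Fin 3, ∀ x y z, ∃ a b c d, homOfCorner a b c d (i, j) = x ∧
        homOfCorner a b c d (i, j + 1) = y ∧ homOfCorner a b c d (i + 1, j) = z := by
      decide +kernel
    obtain ⟨a, b, c, d, h0, h1, h2⟩ := key i j (s (i, j)) (s (i, j + 1)) (s (i + 1, j))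
    have hg := isGlobal_homOfCorner a b c d
    refine ⟨_, hg, fun m hm => ?_⟩
    generalize homOfCorner a b c d = t at *
    have hrow : ∀ f : Fin 3 → ZMod 2, ∑ l, f l = f j + f (j + 1) + f (j + 2) := by
      intro f; rw [Fin.sum_univ_three]; fin_cases j <;> simp <;> ring
    have hcol : ∀ f : Fin 3 → ZMod 2, ∑ l, f l = f i + f (i + 1) + f (i + 2) := by
      intro f; rw [Fin.sum_univ_three]; fin_cases i <;> simp <;> ring
    have hs1 : ∑ m : square.context (.inl i), s m = 0 := hs (.inl i) Finset.subset_union_left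
    have hs2 : ∑ m : square.context (.inr j), s m = 0 := hs (.inr j) Finset.subset_union_right
    have ht1 : ∑ m : square.context (.inl i), t m = 0 := hg (.inl i)
    have ht2 : ∑ m : square.context (.inr j), t m = 0 := hg (.inr j)
    rw [sum_context_inl, hrow] at hs1 ht1
    rw [sum_context_inr, hcol] at hs2 ht2
    have h3 : t (i, j + 2) = s (i, j + 2) := by
      rw [← hs1, h0, h1] at ht1; exact add_left_cancel ht1
    have h4 : t (i + 2, j) = s (i + 2, j) := by
      rw [← hs2, h0, h2] at ht2; exact add_left_cancel ht2
    have hcases : ∀ x y : Fin 3, y = x ∨ y = x + 1 ∨ y = x + 2 := by decide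
    obtain ⟨k, l⟩ := m
    obtain rfl | rfl := mem_cross.1 hm
    · obtain rfl | rfl | rfl := hcases j l
      exacts [h0, h1, h3]
    · obtain rfl | rfl | rfl := hcases i k
      exacts [h0, h2, h4]

/-- The row and column relations determine the five remaining values. The two expressions for the
last one agree, so `homOfCorner` inverts restriction. -/
theorem isHom_restrict_bijective :
    Function.Bijective (fun (s : {s : Meas → ZMod 2 // IsHom s}) => fun m : corner => s.1 m) := by
  constructor
  · rintro ⟨s, hs⟩ ⟨t, ht⟩ hst
    rw [isHom_iff, isGlobal_β₀_iff] at hs ht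
    have h : ∀ m (hm : m ∈ corner), s m = t m := fun m hm => congrFun hst ⟨m, hm⟩
    have h00 := h (0, 0) (by decide)
    have h01 := h (0, 1) (by decide)
    have h10 := h (1, 0) (by decide)
    have h11 := h (1, 1) (by decide)
    have hr : ∀ i, s (i, 0) = t (i, 0) → s (i, 1) = t (i, 1) → s (i, 2) = t (i, 2) := by
      intro i e0 e1
      have := (hs.1 i).trans (ht.1 i).symm
      rw [e0, e1] at this
      exact add_left_cancel this
    have hc : ∀ j, s (0, j) = t (0, j) → s (1, j) = t (1, j) → s (2, j) = t (2, j) := by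
      intro j e0 e1
      have := (hs.2 j).trans (ht.2 j).symm
      rw [e0, e1] at this
      exact add_left_cancel this
    have h02 := hr 0 h00 h01
    have h12 := hr 1 h10 h11
    have h20 := hc 0 h00 h10
    have h21 := hc 1 h01 h11
    have h22 := hc 2 h02 h12
    apply Subtype.ext
    funext ⟨i, j⟩
    fin_cases i <;> fin_cases j
    exacts [h00, h01, h02, h10, h11, h12, h20, h21, h22]
  · intro f
    refine ⟨⟨homOfCorner (f ⟨(0, 0), by decide⟩) (f ⟨(0, 1), by decide⟩) (f ⟨(1, 0), by decide⟩)
      (f ⟨(1, 1), by decide⟩), (isHom_iff _).2 (isGlobal_homOfCorner _ _ _ _)⟩, ?_⟩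
    funext ⟨m, hm⟩
    have hm' := hm
    simp only [corner, Finset.mem_insert, Finset.mem_singleton] at hm'
    obtain rfl | rfl | rfl | rfl := hm' <;> rfl

/-! ### The even case -/

theorem vec_univ_injective {s t : Meas → ZMod 2}
    (h : vec Finset.univ (fun m => s m) = vec Finset.univ fun m => t m) : s = t := by
  funext m
  have := congrFun h m
  rw [vec_of_mem (Finset.mem_univ m), vec_of_mem (Finset.mem_univ m)] at this
  exact sgn_injective this

theorem vec_univ_mem_extremePoints {β : Ctx → ZMod 2} {s : Meas → ZMod 2} (hs : IsGlobal β s) :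
    vec Finset.univ (fun m => s m) ∈ (coordPolytope β).extremePoints ℝ :=
  vec_mem_extremePoints (vec_mem (fun _ _ _ _ _ _ => Finset.subset_univ _) fun C _ => hs C)
    fun _ _ h => funext fun m => h m (Finset.mem_univ m)

theorem exists_eq_vec_univ {u : Meas → ℝ} (hu : u ∈ (coordPolytope β₀).extremePoints ℝ) :
    ∃ s, IsGlobal β₀ s ∧ u = vec Finset.univ fun m => s m := by
  have hout := isOutcomeAssignment_detSet hu.1
  obtain h | h := detSet_of_extreme hu
  · obtain ⟨t, ht, hts⟩ := h.exists_extension hout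
    refine absurd hu (h.not_extreme ht fun m hm => ?_)
    rw [hts m hm]
    exact sgn_signOf (mem_detSet.1 hm)
  · refine ⟨signOf u, fun C => hout C (h ▸ Finset.subset_univ _), funext fun m => ?_⟩
    rw [vec_of_mem (Finset.mem_univ m)]
    exact sgn_signOf (mem_detSet.1 (h ▸ Finset.mem_univ m))

theorem ofCoords_vec_univ {β : Ctx → ZMod 2} {s : Meas → ZMod 2} (hs : IsGlobal β s) (C : Ctx) :
    ofCoords β (vec Finset.univ fun m => s m) C =
      Pi.single (fun m : square.context C => s m) (1 : ℝ) := by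
  funext r
  rw [Pi.single_apply, ofCoords]
  by_cases hr : ∑ m, r m = β C
  · have h := one_add_sum_sgn (r + fun m : square.context C => s m) (by
      simp only [Pi.add_apply, Finset.sum_add_distrib]
      rw [hr, hs C, CharTwo.add_self_eq_zero])
    have he : form C r (vec Finset.univ fun m => s m) =
        ∑ m, sgn ((r + fun m : square.context C => s m) m) :=
      Finset.sum_congr rfl fun m _ => by
        rw [vec_of_mem (Finset.mem_univ _), Pi.add_apply, sgn_add]
    have hiff : (r + fun m : square.context C => s m) = 0 ↔
        r = fun m : square.context C => s m := by
      simp only [funext_iff, Pi.add_apply, Pi.zero_apply, CharTwo.add_eq_zero]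
    rw [if_pos hr, he, h]
    simp only [hiff]
    split_ifs <;> norm_num
  · rw [if_neg hr, if_neg]
    rintro rfl
    exact hr (hs C)

/-- The vertex of `MP₀` attached to a homomorphism. -/
noncomputable def homVertex (s : {s : Meas → ZMod 2 // IsHom s}) : vertices β₀ :=
  ⟨ofCoords β₀ (vec Finset.univ fun m => s.1 m),
    ofCoords_mem_vertices_iff.2 (vec_univ_mem_extremePoints ((isHom_iff _).1 s.2))⟩

theorem homVertex_bijective : Function.Bijective homVertex := by
  constructor
  · intro s t h
    exact Subtype.ext (vec_univ_injective (ofCoords_injective β₀ (congrArg Subtype.val h)))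
  · rintro ⟨p, hp⟩
    have hMP : p ∈ MP β₀ := hp.1
    have hu : coords p ∈ (coordPolytope β₀).extremePoints ℝ := by
      rw [← ofCoords_mem_vertices_iff, ofCoords_coords hMP]; exact hp
    obtain ⟨s, hs, he⟩ := exists_eq_vec_univ hu
    refine ⟨⟨s, (isHom_iff s).2 hs⟩, Subtype.ext ?_⟩
    change ofCoords β₀ (vec Finset.univ fun m => s m) = p
    rw [← he, ofCoords_coords hMP]

theorem ncard_vertices_β₀ : (vertices β₀).ncard = 16 := by
  have hcorner : corner.card = 4 := by decide
  rw [← Nat.card_coe_set_eq, ← Nat.card_congr (Equiv.ofBijective _ homVertex_bijective),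
    Nat.card_congr (Equiv.ofBijective _ isHom_restrict_bijective), Nat.card_eq_fintype_card]
  simp [ZMod.card, hcorner]

/-! ### The odd case -/

instance decidableIsOutcomeAssignment (β : Ctx → ZMod 2) (Ω : Finset Meas) (s : Ω → ZMod 2) :
    Decidable (square.IsOutcomeAssignment β Ω s) :=
  decidable_of_iff (∀ (C : Ctx) (h : square.context C ⊆ Ω),
    ∑ m : square.context C, s ⟨m, h m.2⟩ = β C) Iff.rfl

/-- Five bits under two independent parity conditions leave `2^3` choices. -/
theorem card_outcomeAssignment_cross (i j : Fin 3) :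
    Nat.card {s : cross i j → ZMod 2 // square.IsOutcomeAssignment β₁ (cross i j) s} = 8 := by
  rw [Nat.card_eq_fintype_card]
  revert i j
  decide +kernel

theorem isOutcomeAssignment_transversal (β : Ctx → ZMod 2) (π : Equiv.Perm (Fin 3))
    (s : transversal π → ZMod 2) : square.IsOutcomeAssignment β (transversal π) s := by
  intro C hC
  obtain ⟨a⟩ := nonempty_context C
  obtain ⟨b, c, hab, -⟩ := exists_other_two a
  exact absurd (collinear_iff.2 ⟨C, a.2, b.2⟩)
    (not_collinear_of_mem_transversal (hC a.2) (hC b.2) fun e => hab (Subtype.ext e))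

theorem card_outcomeAssignment_transversal (π : Equiv.Perm (Fin 3)) :
    Nat.card {s : transversal π → ZMod 2 //
      square.IsOutcomeAssignment β₁ (transversal π) s} = 8 := by
  rw [Nat.card_congr (Equiv.subtypeUnivEquiv (isOutcomeAssignment_transversal β₁ π)),
    Nat.card_eq_fintype_card, Fintype.card_fun, Fintype.card_coe, card_transversal, ZMod.card]
  rfl

theorem IsBig.isCnc {Ω : Finset Meas} (hΩ : IsBig Ω) : square.IsCnc β₁ Ω := by
  refine ⟨hΩ.isClosed, ?_⟩
  obtain ⟨π, rfl⟩ | ⟨i, j, rfl⟩ := hΩ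
  · exact ⟨0, isOutcomeAssignment_transversal β₁ π 0⟩
  · have : Nonempty {s : cross i j → ZMod 2 //
        square.IsOutcomeAssignment β₁ (cross i j) s} :=
      (Nat.card_pos_iff.1 (by rw [card_outcomeAssignment_cross]; omega)).1
    obtain ⟨s, hs⟩ := this
    exact ⟨s, hs⟩

theorem not_isCnc_univ : ¬ square.IsCnc β₁ Finset.univ := by
  rintro ⟨-, s, hs⟩
  exact not_exists_isGlobal_β₁
    ⟨fun m => s ⟨m, Finset.mem_univ m⟩, fun C => hs C (Finset.subset_univ _)⟩

/-- The whole square is not cnc, every other closed set lies in a cross or a transversal, and those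
have no closed proper superset but the square. -/
theorem maximal_isCnc_iff (Ω : Finset Meas) : Maximal (square.IsCnc β₁) Ω ↔ IsBig Ω := by
  constructor
  · intro h
    obtain ⟨Ω', hbig, hsub⟩ := IsBig.exists_of_isClosed h.prop.1
      fun e => not_isCnc_univ (e ▸ h.prop)
    rw [h.eq_of_le hbig.isCnc hsub]
    exact hbig
  · intro h
    refine ⟨h.isCnc, fun Ω' hΩ' hsub => ?_⟩
    by_cases he : Ω' = Ω
    · exact he.le
    · exact absurd (h.eq_univ_of_ssubset hΩ'.1 hsub he ▸ hΩ') not_isCnc_univ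

theorem IsBig.vec_mem_extremePoints {Ω : Finset Meas} (hΩ : IsBig Ω) {s : Ω → ZMod 2}
    (hs : square.IsOutcomeAssignment β₁ Ω s) :
    vec Ω s ∈ (coordPolytope β₁).extremePoints ℝ := by
  refine Mermin.vec_mem_extremePoints (vec_mem hΩ.isClosed hs) fun v hv h => funext fun m => ?_
  by_cases hm : m ∈ Ω
  · exact h m hm
  · rw [vec_of_notMem hm]
    exact hΩ.eq_zero_of_notMem not_exists_isGlobal_β₁ hv
      (fun k hk => by rw [h k hk, vec_of_mem hk, abs_sgn]) hm

/-- `Ω` is recovered as the set of coordinates `±1`, and `s` from their signs. -/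
theorem vec_sigma_injective {x y : (Ω : Finset Meas) × (Ω → ZMod 2)}
    (h : vec x.1 x.2 = vec y.1 y.2) : x = y := by
  obtain ⟨Ω, s⟩ := x
  obtain ⟨Ω', s'⟩ := y
  obtain rfl : Ω = Ω' := by
    have := congrArg detSet h
    rwa [detSet_vec, detSet_vec] at this
  congr 1
  funext m
  have := congrFun h m
  rw [vec_of_mem m.2, vec_of_mem m.2] at this
  exact sgn_injective this

/-- The vertex of `MP₁` attached to a maximal cnc set and an outcome assignment. -/
noncomputable def cncVertex (x : square.CncPair β₁) : vertices β₁ :=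
  ⟨ofCoords β₁ (vec x.1.1 x.1.2), ofCoords_mem_vertices_iff.2
    (((maximal_isCnc_iff _).1 x.2.1).vec_mem_extremePoints x.2.2)⟩

theorem cncVertex_bijective : Function.Bijective cncVertex := by
  constructor
  · intro x y h
    exact Subtype.ext (vec_sigma_injective (ofCoords_injective β₁ (congrArg Subtype.val h)))
  · rintro ⟨p, hp⟩
    have hMP : p ∈ MP β₁ := hp.1
    have hu : coords p ∈ (coordPolytope β₁).extremePoints ℝ := by
      rw [← ofCoords_mem_vertices_iff, ofCoords_coords hMP]; exact hp
    have hout := isOutcomeAssignment_detSet hu.1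
    have hbig : IsBig (detSet (coords p)) := by
      obtain h | h := detSet_of_extreme hu
      · exact h
      · exact absurd ⟨signOf (coords p), fun C => hout C (h ▸ Finset.subset_univ _)⟩
          not_exists_isGlobal_β₁
    refine ⟨⟨⟨detSet (coords p), fun m => signOf (coords p) m⟩,
      (maximal_isCnc_iff _).2 hbig, hout⟩, Subtype.ext ?_⟩
    have he : vec (detSet (coords p)) (fun m => signOf (coords p) m) = coords p := by
      funext m
      by_cases hm : m ∈ detSet (coords p)
      · rw [vec_of_mem hm]
        exact (sgn_signOf (mem_detSet.1 hm)).symm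
      · rw [vec_of_notMem hm, hbig.eq_zero_of_notMem not_exists_isGlobal_β₁ hu.1
          (fun _ h => mem_detSet.1 h) hm]
    change ofCoords β₁ (vec (detSet (coords p)) fun m => signOf (coords p) m) = p
    rw [he, ofCoords_coords hMP]

theorem ncard_cncPair {I : Type} [Fintype I] {F : I → Finset Meas} (hF : Function.Injective F)
    (hbig : ∀ i, IsBig (F i)) {k : ℕ}
    (hk : ∀ i, Nat.card {s : F i → ZMod 2 // square.IsOutcomeAssignment β₁ (F i) s} = k) :
    {x : square.CncPair β₁ | ∃ i, x.1.1 = F i}.ncard = Fintype.card I * k := by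
  let g : (Σ i, {s : F i → ZMod 2 // square.IsOutcomeAssignment β₁ (F i) s}) →
      {x : square.CncPair β₁ | ∃ i, x.1.1 = F i} := fun y =>
    ⟨⟨⟨F y.1, y.2.1⟩, (maximal_isCnc_iff _).2 (hbig y.1), y.2.2⟩, y.1, rfl⟩
  have hg : Function.Bijective g := by
    constructor
    · rintro ⟨i, s, hs⟩ ⟨i', s', hs'⟩ h
      have h1 : (⟨F i, s⟩ : (Ω : Finset Meas) × (Ω → ZMod 2)) = ⟨F i', s'⟩ :=
        congrArg (fun z => z.1.1) h
      obtain rfl : i = i' := hF (congrArg Sigma.fst h1)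
      obtain rfl : s = s' := eq_of_heq (Sigma.mk.inj h1).2
      rfl
    · rintro ⟨⟨⟨Ω, s⟩, hmax, hs⟩, i, hi⟩
      obtain rfl : Ω = F i := hi
      exact ⟨⟨i, s, hs⟩, rfl⟩
  rw [← Nat.card_coe_set_eq, ← Nat.card_congr (Equiv.ofBijective g hg), Nat.card_sigma]
  simp only [hk, Finset.sum_const, Finset.card_univ, smul_eq_mul]

theorem transversal_injective : Function.Injective transversal := by
  intro π π' h
  ext1 i
  have : (i, π i) ∈ transversal π' := h ▸ by simp
  exact (mem_transversal.1 this).symm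

theorem cross_injective : Function.Injective fun x : Fin 3 × Fin 3 => cross x.1 x.2 := by
  decide

theorem ncard_type1 : {x : square.CncPair β₁ | square.IsType1 x.1.1}.ncard = 48 := by
  simp only [isType1_iff]
  -- Six permutations with eight assignments each.
  rw [ncard_cncPair transversal_injective (fun π => .inl ⟨π, rfl⟩)
    card_outcomeAssignment_transversal, Fintype.card_perm]
  rfl

theorem ncard_type2 : {x : square.CncPair β₁ | square.IsType2 x.1.1}.ncard = 72 := by
  have h : {x : square.CncPair β₁ | square.IsType2 x.1.1} =
      {x | ∃ y : Fin 3 × Fin 3, x.1.1 = cross y.1 y.2} := by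
    ext x
    simp only [Set.mem_ofPred_eq, isType2_iff, Prod.exists]
  rw [h, ncard_cncPair cross_injective (fun x => .inr ⟨x.1, x.2, rfl⟩)
    fun x => card_outcomeAssignment_cross x.1 x.2]
  rfl

end Mermin

theorem theorem1 :
    -- the even case
    ((∃ e : {s : Mermin.Meas → ZMod 2 // Mermin.IsHom s} ≃ Mermin.vertices Mermin.β₀,
        ∀ s,
          (∀ p ∈ Mermin.MP Mermin.β₀,
            Mermin.square.HasMarginals p Finset.univ (fun m => s.1 m) ↔ p = (e s).1) ∧
          (∀ C, (e s).1 C = Pi.single (fun m : Mermin.square.context C => s.1 m) (1 : ℝ))) ∧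
      Function.Bijective (fun (s : {s : Mermin.Meas → ZMod 2 // Mermin.IsHom s}) =>
        fun m : Mermin.corner => s.1 m) ∧
      (Mermin.vertices Mermin.β₀).ncard = 16) ∧
    -- the odd case
    ((∀ Ω : Finset Mermin.Meas, Maximal (Mermin.square.IsCnc Mermin.β₁) Ω ↔
        Mermin.square.IsType1 Ω ∨ Mermin.square.IsType2 Ω) ∧
      ∃ e : Mermin.square.CncPair Mermin.β₁ ≃ Mermin.vertices Mermin.β₁,
        (∀ x, ∀ p ∈ Mermin.MP Mermin.β₁,
          Mermin.square.HasMarginals p x.1.1 x.1.2 ↔ p = (e x).1) ∧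
        (e '' {x | Mermin.square.IsType1 x.1.1}).ncard = 48 ∧
        (e '' {x | Mermin.square.IsType2 x.1.1}).ncard = 72) := by
  refine ⟨⟨⟨Equiv.ofBijective _ Mermin.homVertex_bijective, fun s => ⟨fun p hp =>
    Mermin.hasMarginals_iff hp, Mermin.ofCoords_vec_univ ((Mermin.isHom_iff _).1 s.2)⟩⟩,
    Mermin.isHom_restrict_bijective, Mermin.ncard_vertices_β₀⟩,
    fun Ω => (Mermin.maximal_isCnc_iff Ω).trans (Mermin.isBig_iff Ω),
    Equiv.ofBijective _ Mermin.cncVertex_bijective, fun x p hp => Mermin.hasMarginals_iff hp,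
    ?_, ?_⟩
  · rw [Set.ncard_image_of_injective _ (Equiv.injective _), Mermin.ncard_type1]
  · rw [Set.ncard_image_of_injective _ (Equiv.injective _), Mermin.ncard_type2]
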